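/- Let $d\ge 1$. For $\eta\in\{0,1\}^d$ let $D^\eta f=\Big(\prod_{j:\,\eta_j=1}\frac{\partial}{\partial x_j}\Big)f$ denote the corresponding mixed partial derivative of $f:\mathbb R^d\to\mathbb C$, so that $D^{\mathbf 0}f=f$, and if $\eta_j=0$ then $D^{\eta+e_j}f=\frac{\partial}{\partial x_j}D^\eta f$ almost everywhere, where $e_j$ is the $j$-th unit vector. Let $f\in C_0(\mathbb R^d)$, that is, $f$ is continuous and $f(x)\to0$ as $|x|\to\infty$. Assume that for every $\eta\neq\mathbf 1=(1,\dots,1)$ and every $j$ with $\eta_j=0$ the function $D^\eta f$ is locally absolutely continuous on $(\mathbb R\setminus\{0\})^d$ in the variable $x_j$, that is, for all fixed nonzero values of the other variables it is absolutely continuous in $x_j$ on every compact interval not containing $0$. Assume that $f\in L_{p_{\mathbf 0}}(\mathbb R^d)$ with $1\le p_{\mathbf 0}<\infty$, and that for every $\eta\in\{0,1\}^d$, $\eta\ne\mathbf 0$, the derivative $D^\eta f$ belongs to $L_{p_\eta}(\mathbb R^d)$ with some $1<p_\eta<\infty$. If $$\frac1{p_{\mathbf 0}}+\frac1{p_\eta}>1\qquad\text{for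 all }\eta\in\{0,1\}^d,\ \eta\ne\mathbf 0,$$ then $f$ is an absolutely convergent Fourier integral, $f\in A(\mathbb R^d)$: there is $g\in L_1(\mathbb R^d)$ such that $$f(y)=\int_{\mathbb R^d}g(x)\,e^{i(x,y)}\,dx\qquad\text{for all }y\in\mathbb R^d,$$ where $(x,y)=\sum_{j=1}^d x_jy_j$. -/

import Mathlib

open MeasureTheory Set
open scoped ZeroAtInfty

/-- `f ∈ A(ℝᵈ)`: `f` is an absolutely convergent Fourier integral, that is,
`f(y) = ∫ g(x) exp(i (x, y)) dx` for every `y ∈ ℝᵈ`, with some `g ∈ L¹(ℝᵈ)`.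
Here `ℝᵈ` is `Fin d → ℝ` with Lebesgue measure, and `(x, y) = ∑ₖ xₖ yₖ`. -/
def IsAbsConvFourierIntegral {d : ℕ} (f : (Fin d → ℝ) → ℂ) : Prop :=
  ∃ g : (Fin d → ℝ) → ℂ, Integrable g volume ∧
    ∀ y : Fin d → ℝ,
      f y = ∫ x : Fin d → ℝ, g x * Complex.exp (Complex.I * ((∑ k, x k * y k : ℝ) : ℂ))

/-- `φ` is locally absolutely continuous on `s ⊆ ℝ`: it is absolutely continuous on every compact
interval contained in `s`. -/
def LocallyAbsContOn (φ : ℝ → ℂ) (s : Set ℝ) : Prop :=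
  ∀ a b : ℝ, uIcc a b ⊆ s → AbsolutelyContinuousOnInterval φ a b

/-- `D` is the family of mixed partial derivatives `D^η f`, `η ∈ {0,1}ᵈ`, of `f`, and the lower ones
are locally absolutely continuous on `(ℝ ∖ {0})ᵈ` in the variables still to be differentiated.

The vector `η ∈ {0,1}ᵈ` is encoded as the set `{j | ηⱼ = 1}`, so `∅` stands for the zero vector and
`Finset.univ` for the vector `(1, …, 1)`. An absolutely continuous function has a derivative only
almost everywhere, hence the derivatives are given by functions `D η` such that `∂/∂xⱼ (D η)` exists
and equals `D (insert j η)` almost everywhere, whenever `j ∉ η`. -/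
structure IsMixedDerivFamily {d : ℕ} (f : (Fin d → ℝ) → ℂ)
    (D : Finset (Fin d) → (Fin d → ℝ) → ℂ) : Prop where
  /-- The derivative of order zero is the function itself. -/
  zero : D ∅ = f
  /-- Every line parallel to the `j`-th axis whose other coordinates are nonzero. -/
  locallyAbsCont : ∀ (η : Finset (Fin d)) (j : Fin d), j ∉ η →
    ∀ x : Fin d → ℝ, (∀ i, i ≠ j → x i ≠ 0) →
      LocallyAbsContOn (fun t : ℝ => D η (Function.update x j t)) {0}ᶜ
  /-- `D^(η + eⱼ) f = ∂/∂xⱼ (D^η f)` almost everywhere. -/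
  hasDeriv : ∀ (η : Finset (Fin d)) (j : Fin d), j ∉ η →
    ∀ᵐ x : Fin d → ℝ ∂volume,
      HasDerivAt (fun t : ℝ => D η (Function.update x j t)) (D (insert j η) x) (x j)

open Filter Topology
open scoped FourierTransform SchwartzMap ContDiff

/-! The argument is of Bernstein type. Let Δ_h f be the mixed difference with step h_k in x_k. On
the Fourier side Δ_h is multiplication by ∏ (1 - exp(2πi h_k ξ_k)), which has modulus at least 1 on
the block 2^(s_k) ≤ |ξ_k| < 2^(s_k + 1) when h_k = 2^(-s_k)/4. Cauchy–Schwarz on each block and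
Plancherel bound the L¹ norm of the transform of f by a constant times the sum over s ∈ ℤᵈ of
2^((s_1 + ... + s_d)/2) ‖Δ_h(s) f‖₂ (`integrable_of_dyadic`).

For this sum to converge it suffices that for every set S of variables ‖Δ_h f‖₂² ≲ ∏ h_k^(α_k), with
α_k > 1 for k ∈ S (used where s_k ≥ 0) and α_k < 1 for k ∉ S (used where s_k < 0). Such bounds come
from ‖Δ_h f‖_p ≲ ∏_{k ∈ η} h_k ‖D^η f‖_p (`lintegral_mixedDiff_rpow_le`), combined with the
boundedness of f or interpolated with its L_{p_0} norm. When one interpolates, the condition 1/p_0 +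
1/p_η > 1 is exactly what puts the exponent on the required side of 1
(`exists_lintegral_mixedDiff_sq_le`).

Two points need care. First, the derivatives are controlled only off the coordinate hyperplanes;
since f is continuous it has no jump there, and the D^η f turn out to be weak derivatives on the
whole space (`integral_mul_prod_deriv`). Second, f need not lie in L², so its transform g is
obtained as the transform of one difference divided by the symbol. The difference between f and the
inverse transform of g then vanishes at infinity and has zero dyadic mixed differences, which forces
it to be zero (`eq_zero_of_mixedDiff_eq_zero`). -/

/-! ### Integration by parts on a punctured line -/

lemma AbsolutelyContinuousOnInterval.comp_lipschitz {X Y : Type*} [PseudoMetricSpace X]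
    [PseudoMetricSpace Y] {u : ℝ → X} {a b : ℝ} {L : X → Y} (hL : LipschitzWith 1 L)
    (hu : AbsolutelyContinuousOnInterval u a b) :
    AbsolutelyContinuousOnInterval (fun t => L (u t)) a b := by
  rw [absolutelyContinuousOnInterval_iff] at hu ⊢
  intro ε hε
  obtain ⟨δ, hδ, H⟩ := hu ε hε
  refine ⟨δ, hδ, fun E hE h => lt_of_le_of_lt (Finset.sum_le_sum fun i _ => ?_) (H E hE h)⟩
  simpa using hL.dist_le_mul (u (E.2 i).1) (u (E.2 i).2)

lemma intervalIntegral_deriv_mul_add_eq_zero_real {u u' ψ : ℝ → ℝ} {a b : ℝ} {K : NNReal}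
    (hu : AbsolutelyContinuousOnInterval u a b) (hψ : LipschitzWith K ψ)
    (ha : ψ a = 0) (hb : ψ b = 0) (hd : ∀ᵐ t, HasDerivAt u (u' t) t) :
    ∫ t in a..b, (u' t * ψ t + u t * deriv ψ t) = 0 := by
  have h := hu.integral_deriv_mul_eq_sub (g := ψ)
    (hψ.lipschitzOnWith (s := uIcc a b)).absolutelyContinuousOnInterval
  rw [ha, hb, mul_zero, mul_zero, sub_zero] at h
  rw [← h]
  refine intervalIntegral.integral_congr_ae ?_
  filter_upwards [hd] with t ht _
  rw [ht.deriv]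

/-- Real and imaginary parts are 1-Lipschitz functions of u, hence absolutely continuous, and the
real case applies to each. -/
lemma intervalIntegral_deriv_mul_add_eq_zero {u u' : ℝ → ℂ} {ψ : ℝ → ℝ} {a b : ℝ} {K : NNReal}
    (hu : AbsolutelyContinuousOnInterval u a b) (hψ : LipschitzWith K ψ)
    (ha : ψ a = 0) (hb : ψ b = 0) (hd : ∀ᵐ t, HasDerivAt u (u' t) t) :
    ∫ t in a..b, (u' t * (ψ t : ℂ) + u t * ((deriv ψ t : ℝ) : ℂ)) = 0 := by
  by_cases hI : IntervalIntegrable (fun t => u' t * (ψ t : ℂ) + u t * ((deriv ψ t : ℝ) : ℂ)) volume a b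
  swap
  · exact intervalIntegral.integral_undef hI
  apply Complex.ext
  · have h := Complex.reCLM.intervalIntegral_comp_comm hI
    simp only [Complex.reCLM_apply] at h
    rw [← h]
    have := intervalIntegral_deriv_mul_add_eq_zero_real (u := fun t => (u t).re)
      (u' := fun t => (u' t).re) (hu.comp_lipschitz (L := Complex.re) ?_) hψ ha hb ?_
    · simpa using this
    · exact LipschitzWith.of_dist_le_mul fun x y => by
        simpa [Real.dist_eq, Complex.dist_eq] using Complex.abs_re_le_norm (x - y)
    · filter_upwards [hd] with t ht
      exact (Complex.reCLM.hasFDerivAt.comp_hasDerivAt t ht)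
  · have h := Complex.imCLM.intervalIntegral_comp_comm hI
    simp only [Complex.imCLM_apply] at h
    rw [← h]
    have := intervalIntegral_deriv_mul_add_eq_zero_real (u := fun t => (u t).im)
      (u' := fun t => (u' t).im) (hu.comp_lipschitz (L := Complex.im) ?_) hψ ha hb ?_
    · simpa using this
    · exact LipschitzWith.of_dist_le_mul fun x y => by
        simpa [Real.dist_eq, Complex.dist_eq] using Complex.abs_im_le_norm (x - y)
    · filter_upwards [hd] with t ht
      exact (Complex.imCLM.hasFDerivAt.comp_hasDerivAt t ht)

/-- Integration by parts on the punctured line. -/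
lemma integral_deriv_mul_add_eq_zero {u u' : ℝ → ℂ} {ψ : ℝ → ℝ} {K : NNReal} {ε R : ℝ}
    (hu : LocallyAbsContOn u {0}ᶜ) (hψ : LipschitzWith K ψ) (hε : 0 < ε) (hεR : ε < R)
    (h0 : ∀ t, |t| ≤ ε → ψ t = 0) (hR : ∀ t, R ≤ |t| → ψ t = 0)
    (hd : ∀ᵐ t, HasDerivAt u (u' t) t) :
    ∫ t, (u' t * (ψ t : ℂ) + u t * ((deriv ψ t : ℝ) : ℂ)) = 0 := by
  set F : ℝ → ℂ := fun t => u' t * (ψ t : ℂ) + u t * ((deriv ψ t : ℝ) : ℂ) with hF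
  -- A non-integrable function has integral 0 by convention, so no integrability has to be assumed
  -- on individual lines.
  by_cases hI : Integrable F
  swap
  · exact integral_undef hI
  have h1 : ∫ t in Ioc ε R, F t = 0 := by
    rw [← intervalIntegral.integral_of_le hεR.le]
    refine intervalIntegral_deriv_mul_add_eq_zero (hu _ _ ?_) hψ
      (h0 _ (abs_of_pos hε).le) (hR _ (le_abs_self R)) hd
    rw [uIcc_of_le hεR.le]
    intro t ht
    simp only [mem_compl_iff, mem_singleton_iff]
    linarith [ht.1]
  have h2 : ∫ t in Ioc (-R) (-ε), F t = 0 := by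
    rw [← intervalIntegral.integral_of_le (by linarith)]
    refine intervalIntegral_deriv_mul_add_eq_zero (hu _ _ ?_) hψ
      (hR _ (by rw [abs_neg]; exact le_abs_self R)) (h0 _ (by rw [abs_neg, abs_of_pos hε])) hd
    rw [uIcc_of_le (by linarith)]
    intro t ht
    simp only [mem_compl_iff, mem_singleton_iff]
    linarith [ht.2]
  have hdis : Disjoint (Ioc (-R) (-ε)) (Ioc ε R) := by
    rw [Set.disjoint_left]
    rintro t ⟨_, h⟩ ⟨h', _⟩
    linarith
  have h3 := setIntegral_union hdis measurableSet_Ioc hI.integrableOn hI.integrableOn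
  rw [h1, h2, add_zero] at h3
  rw [← h3]
  symm
  rw [← integral_indicator (measurableSet_Ioc.union measurableSet_Ioc)]
  -- Outside the two intervals and away from their endpoints, ψ vanishes in a neighbourhood of t, so
  -- its derivative vanishes too.
  have hnull : ∀ᵐ t : ℝ, t ≠ ε ∧ t ≠ -ε ∧ t ≠ R ∧ t ≠ -R := by
    have hne : ∀ a : ℝ, ∀ᵐ t : ℝ, t ≠ a := fun a => by simp [ae_iff, measure_singleton]
    filter_upwards [hne ε, hne (-ε), hne R, hne (-R)] with t a b c d using ⟨a, b, c, d⟩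
  refine integral_congr_ae ?_
  filter_upwards [hnull] with t ht
  by_cases hm : t ∈ Ioc (-R) (-ε) ∪ Ioc ε R
  · rw [indicator_of_mem hm]
  rw [indicator_of_notMem hm]
  change (0 : ℂ) = u' t * (ψ t : ℂ) + u t * ((deriv ψ t : ℝ) : ℂ)
  have hev : ψ =ᶠ[nhds t] fun _ => 0 := by
    have hcase : |t| < ε ∨ R < |t| := by
      by_contra hc
      push Not at hc
      apply hm
      rcases le_total 0 t with h | h
      · rw [abs_of_nonneg h] at hc
        exact Or.inr ⟨lt_of_le_of_ne hc.1 (Ne.symm ht.1), hc.2⟩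
      · rw [abs_of_nonpos h] at hc
        refine Or.inl ⟨lt_of_le_of_ne (by linarith) (Ne.symm ht.2.2.2), by linarith⟩
    rcases hcase with h | h
    · filter_upwards [(isOpen_lt continuous_abs continuous_const).mem_nhds h] with s hs
      exact h0 s (le_of_lt hs)
    · filter_upwards [(isOpen_lt continuous_const continuous_abs).mem_nhds h] with s hs
      exact hR s (le_of_lt hs)
  simp [hev.deriv_eq, hev.eq_of_nhds]

/-! ### Test functions, tensor products and Fubini in one variable -/

/-- Bounded measurable functions of bounded support. -/
structure IsTestFun (g : ℝ → ℝ) : Prop where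
  measurable : Measurable g
  bounded : ∃ M, ∀ t, |g t| ≤ M
  vanish : ∃ R, ∀ t, R ≤ |t| → g t = 0

namespace IsTestFun

lemma exists_pos_radius {g : ℝ → ℝ} (hg : IsTestFun g) (r : ℝ) :
    ∃ R, r < R ∧ ∀ t, R ≤ |t| → g t = 0 := by
  obtain ⟨R, hR⟩ := hg.vanish
  exact ⟨max R (r + 1), lt_of_lt_of_le (by linarith) (le_max_right _ _),
    fun t ht => hR t ((le_max_left _ _).trans ht)⟩

lemma deriv_of_lipschitz {g : ℝ → ℝ} (hg : IsTestFun g) {K : NNReal} (hK : LipschitzWith K g) :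
    IsTestFun (deriv g) := by
  refine ⟨measurable_deriv g, ⟨K, fun t => norm_deriv_le_of_lipschitz hK⟩, ?_⟩
  obtain ⟨R, hR⟩ := hg.vanish
  refine ⟨R + 1, fun t ht => ?_⟩
  have : g =ᶠ[nhds t] fun _ => 0 := by
    filter_upwards [(isOpen_lt continuous_const continuous_abs).mem_nhds
      (show R < |t| by linarith)] with s hs
    exact hR s (le_of_lt hs)
  simp [this.deriv_eq]

lemma mul_bounded {g c : ℝ → ℝ} (hg : IsTestFun g) (hc : Measurable c) {M : ℝ}
    (hM : ∀ t, |c t| ≤ M) : IsTestFun (fun t => g t * c t) := by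
  obtain ⟨B, hB⟩ := hg.bounded
  obtain ⟨R, hR⟩ := hg.vanish
  refine ⟨hg.measurable.mul hc, ⟨B * M, fun t => ?_⟩, ⟨R, fun t ht => by simp [hR t ht]⟩⟩
  rw [abs_mul]
  exact mul_le_mul (hB t) (hM t) (abs_nonneg _) ((abs_nonneg _).trans (hB t))

lemma integrable {g : ℝ → ℝ} (hg : IsTestFun g) : Integrable g := by
  obtain ⟨B, hB⟩ := hg.bounded
  obtain ⟨R, hR⟩ := hg.vanish
  have : IntegrableOn g (Icc (-R) R) :=
    Measure.integrableOn_of_bounded (M := B) (by simp) hg.measurable.aestronglyMeasurable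
      (Filter.Eventually.of_forall hB)
  rw [← integrable_indicator_iff measurableSet_Icc] at this
  refine this.congr (Filter.Eventually.of_forall fun t => ?_)
  by_cases ht : t ∈ Icc (-R) R
  · rw [indicator_of_mem ht]
  · rw [indicator_of_notMem ht, hR]
    by_contra h
    push Not at h
    exact ht (abs_le.1 h.le)

end IsTestFun

section Products
variable {ι : Type*} [Fintype ι] {φ : ι → ℝ → ℝ}

lemma measurable_prod_test (hφ : ∀ k, IsTestFun (φ k)) :
    Measurable fun x : ι → ℝ => ∏ k, φ k (x k) :=
  Finset.measurable_fun_prod _ fun k _ => (hφ k).measurable.comp (measurable_pi_apply k)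

lemma exists_bound_prod_test (hφ : ∀ k, IsTestFun (φ k)) :
    ∃ M, ∀ x : ι → ℝ, |∏ k, φ k (x k)| ≤ M := by
  choose B hB using fun k => (hφ k).bounded
  refine ⟨∏ k, B k, fun x => ?_⟩
  rw [Finset.abs_prod]
  exact Finset.prod_le_prod (fun _ _ => abs_nonneg _) fun k _ => hB k _

lemma exists_radius_prod_test (hφ : ∀ k, IsTestFun (φ k)) :
    ∃ R, ∀ x : ι → ℝ, x ∉ Metric.closedBall 0 R → ∏ k, φ k (x k) = 0 := by
  choose R hR0 hR using fun k => (hφ k).exists_pos_radius 0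
  refine ⟨∑ k, R k, fun x hx => ?_⟩
  have hsum : 0 ≤ ∑ k, R k := Finset.sum_nonneg fun k _ => (hR0 k).le
  rw [mem_closedBall_zero_iff, pi_norm_le_iff_of_nonneg hsum] at hx
  push Not at hx
  obtain ⟨k, hk⟩ := hx
  refine Finset.prod_eq_zero (Finset.mem_univ k) (hR k _ ?_)
  exact (Finset.single_le_sum (f := R) (fun i _ => (hR0 i).le) (Finset.mem_univ k)).trans hk.le

lemma integrable_mul_prod_test {F : (ι → ℝ) → ℂ} (hF : LocallyIntegrable F)
    (hφ : ∀ k, IsTestFun (φ k)) :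
    Integrable fun x => F x * ((∏ k, φ k (x k) : ℝ) : ℂ) := by
  obtain ⟨M, hM⟩ := exists_bound_prod_test hφ
  obtain ⟨R, hR⟩ := exists_radius_prod_test hφ
  have h1 : Integrable ((Metric.closedBall (0 : ι → ℝ) R).indicator F) := by
    rw [integrable_indicator_iff Metric.isClosed_closedBall.measurableSet]
    exact hF.integrableOn_isCompact (isCompact_closedBall _ _)
  have hm : Measurable fun x : ι → ℝ => ((∏ k, φ k (x k) : ℝ) : ℂ) :=
    Complex.measurable_ofReal.comp (measurable_prod_test hφ)
  refine (h1.mul_bdd (c := M) hm.aestronglyMeasurable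
    (Filter.Eventually.of_forall fun x => ?_)).congr (Filter.Eventually.of_forall fun x => ?_)
  · rw [Complex.norm_real, Real.norm_eq_abs]
    exact hM x
  · by_cases hx : x ∈ Metric.closedBall (0 : ι → ℝ) R
    · simp [indicator_of_mem hx]
    · simp only [hR x hx]; simp

end Products

section Fubini
variable {n : ℕ}

lemma integral_insertNth (j : Fin (n + 1)) {F : (Fin (n + 1) → ℝ) → ℂ} (hF : Integrable F) :
    ∫ x, F x = ∫ y : Fin n → ℝ, ∫ t : ℝ, F (j.insertNth t y) := by
  have hmp := (volume_preserving_piFinSuccAbove (fun _ : Fin (n + 1) => ℝ) j).symm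
  rw [← hmp.integral_comp (MeasurableEquiv.measurableEmbedding _)]
  have hI := (hmp.integrable_comp_emb (MeasurableEquiv.measurableEmbedding _)).2 hF
  exact integral_prod_symm _ hI

lemma ae_ae_insertNth (j : Fin (n + 1)) {P : (Fin (n + 1) → ℝ) → Prop} (hP : ∀ᵐ x, P x) :
    ∀ᵐ y : Fin n → ℝ, ∀ᵐ t : ℝ, P (j.insertNth t y) := by
  have hmp := (volume_preserving_piFinSuccAbove (fun _ : Fin (n + 1) => ℝ) j).symm
  have h := hmp.quasiMeasurePreserving.ae hP
  have h2 := (Measure.measurePreserving_swap (μ := (volume : Measure (Fin n → ℝ)))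
    (ν := (volume : Measure ℝ))).quasiMeasurePreserving.ae h
  exact Measure.ae_ae_of_ae_prod h2

lemma ae_forall_ne_zero : ∀ᵐ y : Fin n → ℝ, ∀ i, y i ≠ 0 := by
  rw [ae_all_iff]
  intro i
  have := Measure.pi_hyperplane (fun _ : Fin n => (volume : Measure ℝ)) i 0
  rw [ae_iff]
  simpa [volume_pi] using this

lemma prod_insertNth (j : Fin (n + 1)) (φ : Fin (n + 1) → ℝ → ℝ) (t : ℝ) (y : Fin n → ℝ) :
    ∏ k, φ k ((j.insertNth t y : Fin (n + 1) → ℝ) k) = φ j t * ∏ i, φ (j.succAbove i) (y i) := by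
  rw [Fin.prod_univ_succAbove _ j]
  simp

lemma prod_update_insertNth (j : Fin (n + 1)) (φ : Fin (n + 1) → ℝ → ℝ) (ψ : ℝ → ℝ) (t : ℝ)
    (y : Fin n → ℝ) :
    ∏ k, (Function.update φ j ψ k) ((j.insertNth t y : Fin (n + 1) → ℝ) k) =
      ψ t * ∏ i, φ (j.succAbove i) (y i) := by
  rw [prod_insertNth]
  simp

end Fubini

lemma isTestFun_update {ι : Type*} [DecidableEq ι] {φ : ι → ℝ → ℝ} (hφ : ∀ k, IsTestFun (φ k))
    (j : ι) {ψ : ℝ → ℝ} (hψ : IsTestFun ψ) (k : ι) : IsTestFun (Function.update φ j ψ k) := by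
  rcases eq_or_ne k j with rfl | h
  · simpa using hψ
  · simpa [h] using hφ k

/-- One integration by parts against a test function that vanishes near the hyperplane `x j = 0`. -/
lemma integral_insert_mul_prod {n : ℕ} {f : (Fin (n + 1) → ℝ) → ℂ}
    {D : Finset (Fin (n + 1)) → (Fin (n + 1) → ℝ) → ℂ} (hD : IsMixedDerivFamily f D)
    (hloc : ∀ η, LocallyIntegrable (D η)) {η : Finset (Fin (n + 1))} {j : Fin (n + 1)}
    (hj : j ∉ η) {φ : Fin (n + 1) → ℝ → ℝ} (hφ : ∀ k, IsTestFun (φ k)) {ψ : ℝ → ℝ}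
    (hψ : IsTestFun ψ) {K : NNReal} (hK : LipschitzWith K ψ) {ε : ℝ} (hε : 0 < ε)
    (h0 : ∀ t, |t| ≤ ε → ψ t = 0) :
    ∫ x, D (insert j η) x * ((∏ k, Function.update φ j ψ k (x k) : ℝ) : ℂ) =
      -∫ x, D η x * ((∏ k, Function.update φ j (deriv ψ) k (x k) : ℝ) : ℂ) := by
  have hI1 := integrable_mul_prod_test (hloc (insert j η)) (isTestFun_update hφ j hψ)
  have hI2 := integrable_mul_prod_test (hloc η)
    (isTestFun_update hφ j (hψ.deriv_of_lipschitz hK))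
  rw [eq_neg_iff_add_eq_zero, ← integral_add hI1 hI2]
  have hfub := integral_insertNth j (hI1.add hI2)
  simp only [Pi.add_apply] at hfub
  rw [hfub, ← integral_zero (Fin n → ℝ) ℂ]
  refine integral_congr_ae ?_
  obtain ⟨R, hεR, hR⟩ := hψ.exists_pos_radius ε
  filter_upwards [ae_ae_insertNth j (hD.hasDeriv η j hj), ae_forall_ne_zero] with y hy hy0
  simp only [prod_update_insertNth]
  -- Almost every y has no zero coordinate, so absolute continuity off 0 is available on the line
  -- over y.
  have hline : LocallyAbsContOn (fun t => D η (j.insertNth t y)) {0}ᶜ := by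
    have := hD.locallyAbsCont η j hj (j.insertNth (0 : ℝ) y) fun i hi => by
      obtain ⟨i, rfl⟩ := Fin.exists_succAbove_eq hi
      simpa using hy0 i
    simpa using this
  have hder : ∀ᵐ t, HasDerivAt (fun t => D η (j.insertNth t y)) (D (insert j η) (j.insertNth t y))
      t := by
    filter_upwards [hy] with t ht
    simpa using ht
  have hz := integral_deriv_mul_add_eq_zero hline hK hε hεR h0 hR hder
  calc _ = ∫ t, (D (insert j η) (j.insertNth t y) * (ψ t : ℂ)
        + D η (j.insertNth t y) * ((deriv ψ t : ℝ) : ℂ)) *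
          ((∏ i, φ (j.succAbove i) (y i) : ℝ) : ℂ) := by
        refine integral_congr_ae (Filter.Eventually.of_forall fun t => ?_)
        push_cast
        ring
    _ = 0 := by rw [integral_mul_const, hz, zero_mul]

/-! ### Cutting off near a coordinate hyperplane and removing the cutoff -/

/-- A smooth bump function on the line, equal to `1` on `[-1, 1]` and to `0` off `(-2, 2)`. -/
noncomputable def lineBump : ContDiffBump (0 : ℝ) := ⟨1, 2, one_pos, one_lt_two⟩

/-- A cutoff that vanishes for `|t| ≤ 1 / (n + 1)` and equals `1` for `2 / (n + 1) ≤ |t|`. -/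
noncomputable def originCutoff (n : ℕ) (t : ℝ) : ℝ := 1 - lineBump (((n : ℝ) + 1) * t)

lemma contDiff_lineBump : ContDiff ℝ 1 lineBump := lineBump.contDiff

lemma lineBump_eq_zero {t : ℝ} (ht : 2 ≤ |t|) : lineBump t = 0 :=
  lineBump.zero_of_le_dist (by simpa [lineBump] using ht)

lemma continuous_deriv_lineBump : Continuous (deriv lineBump) :=
  contDiff_lineBump.continuous_deriv le_rfl

lemma isTestFun_lineBump : IsTestFun lineBump :=
  ⟨contDiff_lineBump.continuous.measurable,
    ⟨1, fun t => by rw [abs_of_nonneg lineBump.nonneg]; exact lineBump.le_one⟩,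
    ⟨2, fun _ => lineBump_eq_zero⟩⟩

lemma exists_lipschitz_lineBump : ∃ K, LipschitzWith K lineBump :=
  contDiff_lineBump.lipschitzWith_of_hasCompactSupport lineBump.hasCompactSupport one_ne_zero

lemma isTestFun_deriv_lineBump : IsTestFun (deriv lineBump) :=
  isTestFun_lineBump.deriv_of_lipschitz exists_lipschitz_lineBump.choose_spec

/-- This zero mean is what makes the contribution of the derivative of the cutoff disappear in the
limit. -/
lemma integral_deriv_lineBump : ∫ t, deriv lineBump t = 0 := by
  have h := integral_of_hasDerivAt_of_tendsto (f := lineBump) (f' := deriv lineBump)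
    (m := 0) (n := 0)
    (fun t => (contDiff_lineBump.differentiable one_ne_zero t).hasDerivAt)
    isTestFun_deriv_lineBump.integrable ?_ ?_
  · simpa using h
  · refine tendsto_const_nhds.congr' ?_
    filter_upwards [eventually_le_atBot (-2 : ℝ)] with t ht
    rw [lineBump_eq_zero]
    rw [abs_of_nonpos (by linarith)]
    linarith
  · refine tendsto_const_nhds.congr' ?_
    filter_upwards [eventually_ge_atTop (2 : ℝ)] with t ht
    rw [lineBump_eq_zero]
    exact ht.trans (le_abs_self t)

lemma originCutoff_mem_Icc (n : ℕ) (t : ℝ) : originCutoff n t ∈ Icc (0 : ℝ) 1 :=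
  ⟨sub_nonneg.2 lineBump.le_one, sub_le_self _ lineBump.nonneg⟩

lemma abs_originCutoff_le (n : ℕ) (t : ℝ) : |originCutoff n t| ≤ 1 := by
  rw [abs_of_nonneg (originCutoff_mem_Icc n t).1]
  exact (originCutoff_mem_Icc n t).2

lemma continuous_originCutoff (n : ℕ) : Continuous (originCutoff n) :=
  continuous_const.sub (contDiff_lineBump.continuous.comp (continuous_const.mul continuous_id))

lemma originCutoff_eq_zero {n : ℕ} {t : ℝ} (ht : |t| ≤ 1 / ((n : ℝ) + 1)) :
    originCutoff n t = 0 := by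
  have hn : (0 : ℝ) < (n : ℝ) + 1 := by positivity
  rw [originCutoff, lineBump.one_of_mem_closedBall, sub_self]
  rw [mem_closedBall_zero_iff, Real.norm_eq_abs, abs_mul, abs_of_pos hn]
  rw [le_div_iff₀ hn] at ht
  simpa [lineBump, mul_comm] using ht

lemma hasDerivAt_originCutoff (n : ℕ) (t : ℝ) :
    HasDerivAt (originCutoff n) (-(((n : ℝ) + 1) * deriv lineBump (((n : ℝ) + 1) * t))) t := by
  have h1 : HasDerivAt (fun t : ℝ => ((n : ℝ) + 1) * t) ((n : ℝ) + 1) t := by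
    simpa using (hasDerivAt_id t).const_mul ((n : ℝ) + 1)
  have h2 := (contDiff_lineBump.differentiable one_ne_zero (((n : ℝ) + 1) * t)).hasDerivAt
  have h3 := (h2.comp t h1).const_sub 1
  rwa [mul_comm] at h3

lemma tendsto_originCutoff {t : ℝ} (ht : t ≠ 0) :
    Tendsto (fun n => originCutoff n t) atTop (𝓝 1) := by
  refine tendsto_const_nhds.congr' ?_
  have h : Tendsto (fun n : ℕ => ((n : ℝ) + 1) * |t|) atTop atTop :=
    (tendsto_atTop_add_const_right _ _ tendsto_natCast_atTop_atTop).atTop_mul_const (abs_pos.2 ht)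
  filter_upwards [h.eventually_ge_atTop 2] with n hn
  rw [originCutoff, lineBump_eq_zero, sub_zero]
  rwa [abs_mul, abs_of_pos (show (0 : ℝ) < (n : ℝ) + 1 by positivity)]

lemma ae_ne_zero_real : ∀ᵐ t : ℝ, t ≠ 0 := by simp [ae_iff, measure_singleton]

section
variable {φ : ℝ → ℝ} {K : NNReal}

lemma isTestFun_mul_originCutoff (hφ : IsTestFun φ) (n : ℕ) :
    IsTestFun fun t => φ t * originCutoff n t :=
  hφ.mul_bounded (continuous_originCutoff n).measurable (abs_originCutoff_le n)

lemma exists_lipschitz_mul_originCutoff (hφ : IsTestFun φ) (hK : LipschitzWith K φ) (n : ℕ) :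
    ∃ K', LipschitzWith K' fun t => φ t * originCutoff n t := by
  obtain ⟨B, hB⟩ := hφ.bounded
  obtain ⟨K1, hK1⟩ := exists_lipschitz_lineBump
  have hB0 : 0 ≤ B := (abs_nonneg _).trans (hB 0)
  refine ⟨Real.toNNReal (K + B * (K1 * ((n : ℝ) + 1))), LipschitzWith.of_dist_le_mul fun s t => ?_⟩
  have h1 := hK.dist_le_mul s t
  have h2 := hK1.dist_le_mul (((n : ℝ) + 1) * s) (((n : ℝ) + 1) * t)
  rw [Real.dist_eq] at h1 h2 ⊢
  rw [Real.dist_eq, ← mul_sub, abs_mul, abs_of_pos (show (0 : ℝ) < (n : ℝ) + 1 by positivity)] at h2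
  rw [Real.dist_eq] at h1 ⊢
  have h3 : φ s * originCutoff n s - φ t * originCutoff n t =
      (φ s - φ t) * originCutoff n s
        - φ t * (lineBump (((n : ℝ) + 1) * s) - lineBump (((n : ℝ) + 1) * t)) := by
    unfold originCutoff; ring
  rw [h3]
  refine (abs_sub _ _).trans ?_
  rw [abs_mul, abs_mul]
  have h4 : |φ s - φ t| * |originCutoff n s| ≤ K * |s - t| * 1 :=
    mul_le_mul h1 (abs_originCutoff_le n s) (abs_nonneg _) (by positivity)
  have h5 := mul_le_mul (hB t) h2 (abs_nonneg _) hB0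
  rw [Real.coe_toNNReal _ (by positivity)]
  nlinarith

lemma ae_deriv_mul_originCutoff (hK : LipschitzWith K φ) (n : ℕ) :
    ∀ᵐ t, deriv (fun t => φ t * originCutoff n t) t =
      deriv φ t * originCutoff n t
        - φ t * (((n : ℝ) + 1) * deriv lineBump (((n : ℝ) + 1) * t)) := by
  filter_upwards [hK.ae_differentiableAt (μ := volume)] with t ht
  rw [(ht.hasDerivAt.fun_mul (hasDerivAt_originCutoff n t)).deriv]
  ring

lemma IsTestFun.integrable_mul_of_bounded {w : ℝ → ℝ} (hw : IsTestFun w) {g : ℝ → ℂ} {C : ℝ}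
    (hg : AEStronglyMeasurable g) (hC : ∀ t, ‖g t‖ ≤ C) :
    Integrable fun t => g t * (w t : ℂ) :=
  hw.integrable.ofReal.bdd_mul hg (Eventually.of_forall hC)

/-- The derivative of the cutoff is of order n + 1 on a set of length of order 1/(n + 1).
Substituting s = (n + 1) t absorbs the factor and leaves an integral over a fixed bounded set. -/
lemma integral_mul_deriv_mul_originCutoff (hφ : IsTestFun φ) (hK : LipschitzWith K φ) (n : ℕ)
    {g : ℝ → ℂ} {C : ℝ} (hg : Continuous g) (hC : ∀ t, ‖g t‖ ≤ C) :
    ∫ t, g t * ((deriv (fun t => φ t * originCutoff n t) t : ℝ) : ℂ) =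
      (∫ t, g t * ((deriv φ t * originCutoff n t : ℝ) : ℂ)) -
        ∫ s, g (((n : ℝ) + 1)⁻¹ * s) *
          ((φ (((n : ℝ) + 1)⁻¹ * s) * deriv lineBump s : ℝ) : ℂ) := by
  have hn : (0 : ℝ) < (n : ℝ) + 1 := by positivity
  set G : ℝ → ℂ := fun s => g (((n : ℝ) + 1)⁻¹ * s) *
          ((φ (((n : ℝ) + 1)⁻¹ * s) * deriv lineBump s : ℝ) : ℂ) with hG
  obtain ⟨B, hB⟩ := hφ.bounded
  have hIG : Integrable G := by
    have h := isTestFun_deriv_lineBump.mul_bounded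
      (c := fun s => φ (((n : ℝ) + 1)⁻¹ * s)) (by exact hφ.measurable.comp (by fun_prop))
      (fun s => hB _)
    refine (h.integrable_mul_of_bounded (g := fun s => g (((n : ℝ) + 1)⁻¹ * s))
      (by fun_prop) (fun s => hC _)).congr (Eventually.of_forall fun s => ?_)
    simp only [hG]; push_cast; ring
  have hcv := Measure.integral_comp_mul_left G ((n : ℝ) + 1)
  rw [abs_of_pos (inv_pos.2 hn)] at hcv
  have hcv' : ∫ s, G s = ∫ t, (((n : ℝ) + 1 : ℝ) : ℂ) * G (((n : ℝ) + 1) * t) := by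
    rw [integral_const_mul, hcv, Complex.real_smul, ← mul_assoc, ← Complex.ofReal_mul,
      mul_inv_cancel₀ hn.ne', Complex.ofReal_one, one_mul]
  have hI1 : Integrable fun t => g t * ((deriv φ t * originCutoff n t : ℝ) : ℂ) :=
    ((hφ.deriv_of_lipschitz hK).mul_bounded (continuous_originCutoff n).measurable
      (abs_originCutoff_le n)).integrable_mul_of_bounded hg.aestronglyMeasurable hC
  rw [hcv', ← integral_sub hI1 ((hIG.comp_mul_left' hn.ne').const_mul _)]
  refine integral_congr_ae ?_
  filter_upwards [ae_deriv_mul_originCutoff hK n] with t ht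
  rw [ht]
  simp only [hG, inv_mul_cancel_left₀ hn.ne']
  push_cast
  ring

/-- Uniformity in both n and g supplies the dominating function when the limit is taken under the
integral over the remaining variables. -/
lemma norm_integral_mul_deriv_mul_originCutoff_le (hφ : IsTestFun φ) (hK : LipschitzWith K φ)
    {C : ℝ} : ∃ B, ∀ (n : ℕ) (g : ℝ → ℂ), Continuous g → (∀ t, ‖g t‖ ≤ C) →
      ‖∫ t, g t * ((deriv (fun t => φ t * originCutoff n t) t : ℝ) : ℂ)‖ ≤ B := by
  obtain ⟨M, hM⟩ := hφ.bounded
  refine ⟨(∫ t, C * |deriv φ t|) + ∫ s, C * (M * |deriv lineBump s|), fun n g hg hC => ?_⟩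
  have hC0 : 0 ≤ C := (norm_nonneg _).trans (hC 0)
  rw [integral_mul_deriv_mul_originCutoff hφ hK n hg hC]
  refine (norm_sub_le _ _).trans (add_le_add ?_ ?_)
  · refine norm_integral_le_of_norm_le ((hφ.deriv_of_lipschitz hK).integrable.abs.const_mul C)
      (Eventually.of_forall fun t => ?_)
    rw [norm_mul, Complex.norm_real, Real.norm_eq_abs, abs_mul]
    refine mul_le_mul (hC t) ?_ (by positivity) hC0
    exact mul_le_of_le_one_right (abs_nonneg _) (abs_originCutoff_le n t)
  · refine norm_integral_le_of_norm_le
      ((isTestFun_deriv_lineBump.integrable.abs.const_mul M).const_mul C)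
      (Eventually.of_forall fun t => ?_)
    rw [norm_mul, Complex.norm_real, Real.norm_eq_abs, abs_mul]
    exact mul_le_mul (hC _) (mul_le_mul_of_nonneg_right (hM _) (abs_nonneg _)) (by positivity) hC0

/-- By continuity at 0 the rescaled term tends to g(0) φ(0) times the integral of the derivative of
`lineBump`, which is 0: a continuous function leaves no delta mass at the puncture. -/
lemma tendsto_integral_mul_deriv_mul_originCutoff (hφ : IsTestFun φ) (hK : LipschitzWith K φ)
    {g : ℝ → ℂ} {C : ℝ} (hg : Continuous g) (hC : ∀ t, ‖g t‖ ≤ C) :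
    Tendsto (fun n : ℕ => ∫ t, g t * ((deriv (fun t => φ t * originCutoff n t) t : ℝ) : ℂ)) atTop
      (𝓝 (∫ t, g t * ((deriv φ t : ℝ) : ℂ))) := by
  obtain ⟨M, hM⟩ := hφ.bounded
  have hC0 : 0 ≤ C := (norm_nonneg _).trans (hC 0)
  simp_rw [fun n => integral_mul_deriv_mul_originCutoff hφ hK n hg hC]
  have hφ' := hφ.deriv_of_lipschitz hK
  have h1 : Tendsto (fun n : ℕ => ∫ t, g t * ((deriv φ t * originCutoff n t : ℝ) : ℂ)) atTop
      (𝓝 (∫ t, g t * ((deriv φ t : ℝ) : ℂ))) := by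
    refine tendsto_integral_of_dominated_convergence (fun t => C * |deriv φ t|) (fun n => ?_)
      (hφ'.integrable.abs.const_mul C) (fun n => Eventually.of_forall fun t => ?_) ?_
    · exact ((hφ'.mul_bounded (continuous_originCutoff n).measurable
        (abs_originCutoff_le n)).integrable_mul_of_bounded hg.aestronglyMeasurable hC).1
    · rw [norm_mul, Complex.norm_real, Real.norm_eq_abs, abs_mul]
      refine mul_le_mul (hC t) ?_ (by positivity) hC0
      exact mul_le_of_le_one_right (abs_nonneg _) (abs_originCutoff_le n t)
    · filter_upwards [ae_ne_zero_real] with t ht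
      have := ((tendsto_originCutoff ht).const_mul (deriv φ t)).ofReal.const_mul (g t)
      simpa using this
  have h2 : Tendsto (fun n : ℕ => ∫ s, g (((n : ℝ) + 1)⁻¹ * s) *
          ((φ (((n : ℝ) + 1)⁻¹ * s) * deriv lineBump s : ℝ) : ℂ)) atTop
      (𝓝 (∫ s, g 0 * ((φ 0 * deriv lineBump s : ℝ) : ℂ))) := by
    refine tendsto_integral_of_dominated_convergence (fun s => C * (M * |deriv lineBump s|))
      (fun n => ?_) ((isTestFun_deriv_lineBump.integrable.abs.const_mul M).const_mul C)
      (fun n => Eventually.of_forall fun t => ?_) (Eventually.of_forall fun s => ?_)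
    · have := hK.continuous
      have := continuous_deriv_lineBump
      exact Continuous.aestronglyMeasurable (by fun_prop)
    · rw [norm_mul, Complex.norm_real, Real.norm_eq_abs, abs_mul]
      exact mul_le_mul (hC _) (mul_le_mul_of_nonneg_right (hM _) (abs_nonneg _)) (by positivity) hC0
    · have h0 : Tendsto (fun n : ℕ => ((n : ℝ) + 1)⁻¹ * s) atTop (𝓝 0) := by
        have := (tendsto_one_div_add_atTop_nhds_zero_nat (𝕜 := ℝ)).mul_const s
        simpa using this
      exact ((hg.tendsto 0).comp h0).mul
        ((((hK.continuous.tendsto 0).comp h0).mul_const _).ofReal)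
  have h3 : ∫ s, g 0 * ((φ 0 * deriv lineBump s : ℝ) : ℂ) = 0 := by
    rw [integral_const_mul, integral_complex_ofReal, integral_const_mul, integral_deriv_lineBump]
    simp
  rw [h3] at h2
  simpa using h1.sub h2

end

lemma continuous_insertNth_prod {n : ℕ} (j : Fin (n + 1)) :
    Continuous fun z : (Fin n → ℝ) × ℝ => (j.insertNth z.2 z.1 : Fin (n + 1) → ℝ) :=
  Continuous.finInsertNth j continuous_snd continuous_fst

lemma tendsto_integral_mul_prod_deriv_originCutoff {n : ℕ} {f : (Fin (n + 1) → ℝ) → ℂ} {C : ℝ}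
    (hf : Continuous f) (hC : ∀ x, ‖f x‖ ≤ C) (j : Fin (n + 1)) {c : Fin (n + 1) → ℝ → ℝ}
    (hc : ∀ k, IsTestFun (c k)) {φ : ℝ → ℝ} {K : NNReal} (hφ : IsTestFun φ)
    (hK : LipschitzWith K φ) :
    Tendsto (fun m : ℕ => ∫ x, f x * ((∏ k,
        Function.update c j (deriv fun t => φ t * originCutoff m t) k (x k) : ℝ) : ℂ)) atTop
      (𝓝 (∫ x, f x * ((∏ k, Function.update c j (deriv φ) k (x k) : ℝ) : ℂ))) := by
  have key : ∀ w : ℝ → ℝ, IsTestFun w →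
      ∫ x, f x * ((∏ k, Function.update c j w k (x k) : ℝ) : ℂ) =
        ∫ y : Fin n → ℝ, (∫ t, f (j.insertNth t y) * (w t : ℂ)) *
          ((∏ i, c (j.succAbove i) (y i) : ℝ) : ℂ) := by
    intro w hw
    rw [integral_insertNth j (integrable_mul_prod_test hf.locallyIntegrable
      (isTestFun_update hc j hw))]
    congr 1
    ext y
    rw [← integral_mul_const]
    congr 1
    ext t
    rw [prod_update_insertNth]
    push_cast
    ring
  have hw : ∀ m : ℕ, IsTestFun (deriv fun t => φ t * originCutoff m t) := fun m =>
    (isTestFun_mul_originCutoff hφ m).deriv_of_lipschitz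
      (exists_lipschitz_mul_originCutoff hφ hK m).choose_spec
  simp_rw [fun m => key _ (hw m), key _ (hφ.deriv_of_lipschitz hK)]
  obtain ⟨B, hB⟩ := norm_integral_mul_deriv_mul_originCutoff_le hφ hK (C := C)
  have hins := continuous_insertNth_prod j
  have hline : ∀ y : Fin n → ℝ, Continuous fun t => f (j.insertNth t y) := fun y =>
    hf.comp (hins.comp (Continuous.prodMk_right y))
  have hcI : Integrable fun y : Fin n → ℝ => ((∏ i, c (j.succAbove i) (y i) : ℝ) : ℂ) := by
    have := integrable_mul_prod_test (F := fun _ => (1 : ℂ)) (continuous_const.locallyIntegrable)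
      (fun i => hc (j.succAbove i))
    simpa using this
  refine tendsto_integral_of_dominated_convergence
    (fun y => B * ‖((∏ i, c (j.succAbove i) (y i) : ℝ) : ℂ)‖) (fun m => ?_) (hcI.norm.const_mul B)
    (fun m => Eventually.of_forall fun y => ?_) (Eventually.of_forall fun y => ?_)
  · refine AEStronglyMeasurable.mul ?_ hcI.1
    refine (StronglyMeasurable.integral_prod_right (ν := volume)
      (f := fun (y : Fin n → ℝ) t => f (j.insertNth t y) *
        ((deriv (fun t => φ t * originCutoff m t) t : ℝ) : ℂ)) ?_).aestronglyMeasurable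
    refine (Measurable.mul ?_ ?_).stronglyMeasurable
    · exact (hf.comp hins).measurable
    · exact Complex.measurable_ofReal.comp ((hw m).measurable.comp measurable_snd)
  · rw [norm_mul]
    exact mul_le_mul_of_nonneg_right (hB m _ (hline y) fun t => hC _) (norm_nonneg _)
  · exact (tendsto_integral_mul_deriv_mul_originCutoff hφ hK (hline y) fun t => hC _).mul_const _

/-! ### Weak derivatives on the whole space -/

/-- The functions `D η` are the mixed derivatives of `f` in the weak sense on the whole space. -/
theorem integral_mul_prod_deriv {d : ℕ} {f : (Fin d → ℝ) → ℂ} {C : ℝ}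
    (hf : Continuous f) (hC : ∀ x, ‖f x‖ ≤ C)
    {D : Finset (Fin d) → (Fin d → ℝ) → ℂ} (hD : IsMixedDerivFamily f D)
    (hloc : ∀ η, LocallyIntegrable (D η)) (η : Finset (Fin d)) :
    ∀ φ : Fin d → ℝ → ℝ, (∀ k, IsTestFun (φ k)) → (∀ k ∈ η, ∃ K, LipschitzWith K (φ k)) →
      ∫ x, f x * ((∏ k, (if k ∈ η then deriv (φ k) else φ k) (x k) : ℝ) : ℂ) =
        (-1) ^ η.card * ∫ x, D η x * ((∏ k, φ k (x k) : ℝ) : ℂ) := by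
  induction η using Finset.induction with
  | empty => intro φ _ _; simp [hD.zero]
  | insert j η hj ih =>
    intro φ hφ hL
    obtain _ | n := d
    · exact j.elim0
    obtain ⟨K, hK⟩ := hL j (Finset.mem_insert_self _ _)
    set c : Fin (n + 1) → ℝ → ℝ := fun k => if k ∈ η then deriv (φ k) else φ k with hcdef
    have hc : ∀ k, IsTestFun (c k) := by
      intro k
      simp only [hcdef]
      split_ifs with hk
      · obtain ⟨K', hK'⟩ := hL k (Finset.mem_insert_of_mem hk)
        exact (hφ k).deriv_of_lipschitz hK'
      · exact hφ k
    -- The cutoff is removed on this side only after every derivative has been moved to the test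
    -- functions, so that continuity is needed of `f` alone and not of the intermediate `D η`.
    have hlim1 := tendsto_integral_mul_prod_deriv_originCutoff hf hC j hc (hφ j) hK
    -- Here local integrability suffices: the cutoff is at most 1 in modulus and tends to 1 off the
    -- hyperplane.
    have hlim2 : Tendsto (fun m : ℕ => ∫ x, D (insert j η) x * ((∏ k,
        Function.update φ j (fun t => φ j t * originCutoff m t) k (x k) : ℝ) : ℂ)) atTop
        (𝓝 (∫ x, D (insert j η) x * ((∏ k, φ k (x k) : ℝ) : ℂ))) := by
      have hI := integrable_mul_prod_test (hloc (insert j η)) hφ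
      refine tendsto_integral_of_dominated_convergence _ (fun m => ?_) hI.norm
        (fun m => Eventually.of_forall fun x => ?_) ?_
      · exact (integrable_mul_prod_test (hloc _)
          (isTestFun_update hφ j (isTestFun_mul_originCutoff (hφ j) m))).1
      · rw [norm_mul, norm_mul, Complex.norm_real, Complex.norm_real]
        refine mul_le_mul_of_nonneg_left ?_ (norm_nonneg _)
        rw [Real.norm_eq_abs, Real.norm_eq_abs, Finset.abs_prod, Finset.abs_prod]
        refine Finset.prod_le_prod (fun _ _ => abs_nonneg _) fun k _ => ?_
        rcases eq_or_ne k j with rfl | h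
        · simp only [Function.update_self, abs_mul]
          exact mul_le_of_le_one_right (abs_nonneg _) (abs_originCutoff_le m _)
        · simp [h]
      · filter_upwards [ae_forall_ne_zero] with x hx
        refine ((tendsto_finsetProd _ fun k _ => ?_).ofReal).const_mul _
        rcases eq_or_ne k j with rfl | h
        · simpa using (tendsto_originCutoff (hx k)).const_mul (φ k (x k))
        · simp [h]
    -- One integration by parts in x_j is legitimate because of the cutoff. The induction hypothesis
    -- is then applied with the derivative of the cut-off function as j-th factor.
    have heq : ∀ m : ℕ, ∫ x, f x * ((∏ k,
        Function.update c j (deriv fun t => φ j t * originCutoff m t) k (x k) : ℝ) : ℂ) =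
        (-1) ^ (insert j η).card * ∫ x, D (insert j η) x * ((∏ k,
        Function.update φ j (fun t => φ j t * originCutoff m t) k (x k) : ℝ) : ℂ) := by
      intro m
      obtain ⟨K', hK'⟩ := exists_lipschitz_mul_originCutoff (hφ j) hK m
      have hψ := isTestFun_mul_originCutoff (hφ j) m
      rw [integral_insert_mul_prod hD hloc hj hφ hψ hK'
        (show (0 : ℝ) < 1 / ((m : ℝ) + 1) by positivity)
        (fun t ht => by rw [originCutoff_eq_zero ht, mul_zero]),
        Finset.card_insert_of_notMem hj, pow_succ, mul_neg, mul_neg_one, neg_mul, neg_neg,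
        ← ih _ (isTestFun_update hφ j (hψ.deriv_of_lipschitz hK')) ?_]
      · congr 1
        ext x
        congr 3
        ext k
        rcases eq_or_ne k j with rfl | h
        · simp [hj]
        · simp [h, hcdef]
      · intro k hk
        have hkj : k ≠ j := fun h => hj (h ▸ hk)
        simpa [hkj] using hL k (Finset.mem_insert_of_mem hk)
    have hfin := tendsto_nhds_unique (hlim1.congr heq) (hlim2.const_mul _)
    rw [← hfin]
    congr 1
    ext x
    congr 3
    ext k
    rcases eq_or_ne k j with rfl | h
    · simp
    · simp [h, hcdef]

/-! ### Mixed differences -/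

section MixedDifferences
variable {ι : Type*} [Fintype ι] [DecidableEq ι]

/-- The vector with coordinates `h k` for `k ∈ S` and `0` otherwise. -/
def partialShift (h : ι → ℝ) (S : Finset ι) : ι → ℝ := fun k => if k ∈ S then h k else 0

/-- The mixed difference of `f` with step `h k` in the `k`-th variable. -/
noncomputable def mixedDiff (h : ι → ℝ) (f : (ι → ℝ) → ℂ) (x : ι → ℝ) : ℂ :=
  ∑ S : Finset ι, (-1) ^ S.card * f (x + partialShift h S)

/-- In the expanded product, `S` is the set of variables in which the shifted factor is chosen. Thus
integrating against a tensor product of differences of a kernel gives the mixed difference of the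
mollified function. -/
lemma prod_sub_shift (h : ι → ℝ) (ψ : ℝ → ℝ) (x y : ι → ℝ) :
    ∏ k, (ψ (y k - x k) - ψ (y k - x k - h k)) =
      ∑ S : Finset ι, (-1) ^ S.card * ∏ k, ψ (y k - (x + partialShift h S) k) := by
  rw [Finset.prod_sub, Finset.powerset_univ]
  refine Finset.sum_congr rfl fun S _ => ?_
  rw [mul_assoc, ← Finset.prod_sdiff (Finset.subset_univ S)
    (f := fun k => ψ (y k - (x + partialShift h S) k))]
  congr 2
  · refine Finset.prod_congr rfl fun k hk => ?_
    simp [partialShift, (Finset.mem_sdiff.1 hk).2]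
  · refine Finset.prod_congr rfl fun k hk => ?_
    simp [partialShift, hk, sub_sub]

end MixedDifferences

/-! ### Mollifier kernels, their differences and primitives -/

/-- An approximate identity on the line. -/
noncomputable def lineKernel (n : ℕ) : ℝ → ℝ :=
  (⟨1 / (2 * ((n : ℝ) + 1)), 1 / ((n : ℝ) + 1), by positivity, by
    apply one_div_lt_one_div_of_lt <;> linarith [(n.cast_nonneg : (0 : ℝ) ≤ n)]⟩ :
    ContDiffBump (0 : ℝ)).normed volume

section LineKernel
variable (n : ℕ)

lemma lineKernel_nonneg (t : ℝ) : 0 ≤ lineKernel n t := ContDiffBump.nonneg_normed _ _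

lemma continuous_lineKernel : Continuous (lineKernel n) := ContDiffBump.continuous_normed _

lemma integral_lineKernel : ∫ t, lineKernel n t = 1 := ContDiffBump.integral_normed _

lemma lineKernel_eq_zero {t : ℝ} (ht : 1 / ((n : ℝ) + 1) ≤ |t|) : lineKernel n t = 0 := by
  by_contra h
  have h1 : t ∈ Function.support (lineKernel n) := h
  rw [lineKernel, ContDiffBump.support_normed_eq, Metric.mem_ball, dist_zero_right,
    Real.norm_eq_abs] at h1
  exact absurd h1 (not_lt.2 ht)

lemma lineKernel_eq_zero_of_one_le {t : ℝ} (ht : 1 ≤ |t|) : lineKernel n t = 0 := by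
  refine lineKernel_eq_zero n (le_trans ?_ ht)
  rw [div_le_one (by positivity)]
  linarith [(n.cast_nonneg : (0 : ℝ) ≤ n)]

lemma isTestFun_lineKernel : IsTestFun (lineKernel n) := by
  refine ⟨(continuous_lineKernel n).measurable, ?_, ⟨1, fun _ => lineKernel_eq_zero_of_one_le n⟩⟩
  have hc : HasCompactSupport (lineKernel n) :=
    HasCompactSupport.of_support_subset_isCompact (isCompact_Icc (a := (-1 : ℝ)) (b := 1))
      fun t ht => by
        by_contra h
        refine ht (lineKernel_eq_zero_of_one_le n ?_)
        by_contra h'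
        push Not at h'
        exact h (abs_le.1 h'.le)
  obtain ⟨M, hM⟩ := hc.exists_bound_of_continuous (continuous_lineKernel n)
  exact ⟨M, hM⟩

end LineKernel

lemma IsTestFun.comp_sub {g : ℝ → ℝ} (hg : IsTestFun g) (a : ℝ) :
    IsTestFun fun t => g (t - a) := by
  obtain ⟨M, hM⟩ := hg.bounded
  obtain ⟨R, hR⟩ := hg.vanish
  refine ⟨hg.measurable.comp (measurable_id.sub_const a), ⟨M, fun t => hM _⟩,
    ⟨R + |a|, fun t ht => hR _ ?_⟩⟩
  have := abs_sub_abs_le_abs_sub t a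
  linarith

lemma IsTestFun.sub {g g' : ℝ → ℝ} (hg : IsTestFun g) (hg' : IsTestFun g') :
    IsTestFun fun t => g t - g' t := by
  obtain ⟨M, hM⟩ := hg.bounded
  obtain ⟨R, hR⟩ := hg.vanish
  obtain ⟨M', hM'⟩ := hg'.bounded
  obtain ⟨R', hR'⟩ := hg'.vanish
  refine ⟨hg.measurable.sub hg'.measurable, ⟨M + M', fun t => (abs_sub _ _).trans
    (add_le_add (hM t) (hM' t))⟩, ⟨max R R', fun t ht => ?_⟩⟩
  rw [hR t ((le_max_left _ _).trans ht), hR' t ((le_max_right _ _).trans ht), sub_zero]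

/-- The difference of the approximate identity with step `h`. -/
noncomputable def kernelDiff (n : ℕ) (h t : ℝ) : ℝ := lineKernel n t - lineKernel n (t - h)

/-- The primitive of `kernelDiff n h` of bounded support. -/
noncomputable def kernelMean (n : ℕ) (h t : ℝ) : ℝ := ∫ s in (0 : ℝ)..h, lineKernel n (t - s)

section Kernels
variable (n : ℕ) (h : ℝ)

lemma isTestFun_kernelDiff : IsTestFun (kernelDiff n h) :=
  (isTestFun_lineKernel n).sub ((isTestFun_lineKernel n).comp_sub h)

lemma integral_abs_kernelDiff_le : ∫ t, |kernelDiff n h t| ≤ 2 := by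
  have h1 := (isTestFun_lineKernel n).integrable
  have h2 := ((isTestFun_lineKernel n).comp_sub h).integrable
  calc ∫ t, |kernelDiff n h t| ≤ ∫ t, (lineKernel n t + lineKernel n (t - h)) := by
        refine integral_mono (isTestFun_kernelDiff n h).integrable.abs (h1.add h2) fun t => ?_
        refine (abs_sub _ _).trans ?_
        rw [abs_of_nonneg (lineKernel_nonneg n _), abs_of_nonneg (lineKernel_nonneg n _)]
    _ = 2 := by
        rw [integral_add h1 h2, integral_sub_right_eq_self (lineKernel n), integral_lineKernel]
        norm_num

/-- Integration by parts can therefore replace `kernelDiff`, of L¹ norm at most 2, by `kernelMean`,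
of L¹ norm at most h. -/
lemma hasDerivAt_kernelMean (t : ℝ) : HasDerivAt (kernelMean n h) (kernelDiff n h t) t := by
  have hc := continuous_lineKernel n
  have h1 : kernelMean n h = fun t => (∫ s in (0 : ℝ)..t, lineKernel n s) -
      ∫ s in (0 : ℝ)..(t - h), lineKernel n s := by
    ext t
    rw [kernelMean, intervalIntegral.integral_comp_sub_left, sub_zero,
      intervalIntegral.integral_interval_sub_left (hc.intervalIntegrable _ _)
        (hc.intervalIntegrable _ _)]
  rw [h1]
  exact (hc.integral_hasStrictDerivAt 0 t).hasDerivAt.sub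
    ((hc.integral_hasStrictDerivAt 0 (t - h)).hasDerivAt.comp_sub_const t h)

lemma deriv_kernelMean : deriv (kernelMean n h) = kernelDiff n h :=
  funext fun t => (hasDerivAt_kernelMean n h t).deriv

lemma exists_lipschitz_kernelMean : ∃ K, LipschitzWith K (kernelMean n h) := by
  obtain ⟨M, hM⟩ := (isTestFun_kernelDiff n h).bounded
  refine ⟨M.toNNReal, lipschitzWith_of_nnnorm_deriv_le
    (fun t => (hasDerivAt_kernelMean n h t).differentiableAt) fun t => ?_⟩
  rw [deriv_kernelMean, ← NNReal.coe_le_coe, coe_nnnorm,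
    Real.coe_toNNReal _ ((abs_nonneg _).trans (hM 0))]
  exact hM t

variable {h}

lemma isTestFun_kernelMean (hh : 0 ≤ h) : IsTestFun (kernelMean n h) := by
  obtain ⟨M, hM⟩ := (isTestFun_lineKernel n).bounded
  refine ⟨(continuous_iff_continuousAt.2 fun t =>
    (hasDerivAt_kernelMean n h t).continuousAt).measurable, ⟨M * |h - 0|, fun t => ?_⟩,
    ⟨1 + h, fun t ht => ?_⟩⟩
  · have := intervalIntegral.norm_integral_le_of_norm_le_const (a := 0) (b := h)
      (f := fun s => lineKernel n (t - s)) (C := M) fun s _ => hM _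
    exact this
  · rw [kernelMean, intervalIntegral.integral_zero_ae]
    refine Eventually.of_forall fun s hs => lineKernel_eq_zero_of_one_le n ?_
    rw [uIoc_of_le hh] at hs
    have := abs_sub_abs_le_abs_sub t s
    rw [abs_of_pos hs.1] at this
    linarith [hs.2]

/-- By Tonelli: `kernelMean` superposes translates of a kernel of mass 1 over a parameter interval
of length h. This factor h is the gain from one derivative. -/
lemma integral_kernelMean (hh : 0 ≤ h) : ∫ t, |kernelMean n h t| ≤ h := by
  have h0 : ∫⁻ t, ‖kernelMean n h t‖ₑ ≤ ENNReal.ofReal h := by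
    calc ∫⁻ t, ‖kernelMean n h t‖ₑ ≤ ∫⁻ t, ∫⁻ s in Ioc 0 h, ‖lineKernel n (t - s)‖ₑ := by
          refine lintegral_mono fun t => ?_
          rw [kernelMean, intervalIntegral.integral_of_le hh]
          exact enorm_integral_le_lintegral_enorm _
      _ = ∫⁻ s in Ioc 0 h, ∫⁻ t, ‖lineKernel n (t - s)‖ₑ := by
          refine lintegral_lintegral_swap (Measurable.aemeasurable ?_)
          exact ((continuous_lineKernel n).comp (continuous_fst.sub continuous_snd)).measurable.enorm
      _ = ∫⁻ s in Ioc 0 h, 1 := by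
          refine lintegral_congr fun s => ?_
          rw [lintegral_sub_right_eq_self (fun t => ‖lineKernel n t‖ₑ) s,
            ← ofReal_integral_norm_eq_lintegral_enorm (isTestFun_lineKernel n).integrable]
          simp_rw [Real.norm_of_nonneg (lineKernel_nonneg n _)]
          rw [integral_lineKernel, ENNReal.ofReal_one]
      _ = ENNReal.ofReal h := by simp
  rw [← ofReal_integral_norm_eq_lintegral_enorm (isTestFun_kernelMean n hh).integrable] at h0
  exact (ENNReal.ofReal_le_ofReal_iff hh).1 h0

end Kernels

section ApproximateIdentity
variable {ι : Type*} [Fintype ι]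

lemma tendsto_integral_mul_prod_lineKernel {f : (ι → ℝ) → ℂ} (hf : Continuous f) (a : ι → ℝ) :
    Tendsto (fun n => ∫ y, f y * ((∏ k, lineKernel n (y k - a k) : ℝ) : ℂ)) atTop (𝓝 (f a)) := by
  rw [Metric.tendsto_atTop]
  intro ε hε
  obtain ⟨δ, hδ, H⟩ := Metric.continuous_iff.1 hf a (ε / 2) (half_pos hε)
  obtain ⟨N, hN⟩ := exists_nat_one_div_lt hδ
  refine ⟨N, fun n hn => ?_⟩
  have hφ : ∀ k, IsTestFun fun t => lineKernel n (t - a k) := fun k =>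
    (isTestFun_lineKernel n).comp_sub (a k)
  have hP : ∫ y : ι → ℝ, ∏ k, lineKernel n (y k - a k) = 1 := by
    rw [integral_fintype_prod_volume_eq_prod (fun k t => lineKernel n (t - a k))]
    simp_rw [integral_sub_right_eq_self (lineKernel n), integral_lineKernel, Finset.prod_const_one]
  have hPI : Integrable fun y : ι → ℝ => ∏ k, lineKernel n (y k - a k) :=
    Integrable.fintype_prod (fun k => (hφ k).integrable)
  have hP0 : ∀ y : ι → ℝ, 0 ≤ ∏ k, lineKernel n (y k - a k) := fun y =>
    Finset.prod_nonneg fun k _ => lineKernel_nonneg n _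
  have hI := integrable_mul_prod_test hf.locallyIntegrable hφ
  have hfa : f a = ∫ y : ι → ℝ, f a * ((∏ k, lineKernel n (y k - a k) : ℝ) : ℂ) := by
    rw [integral_const_mul, integral_complex_ofReal, hP]
    simp
  have hIc : Integrable fun y : ι → ℝ => f a * ((∏ k, lineKernel n (y k - a k) : ℝ) : ℂ) :=
    hPI.ofReal.const_mul _
  rw [dist_eq_norm, hfa, ← integral_sub hI hIc]
  refine lt_of_le_of_lt (norm_integral_le_of_norm_le (hPI.const_mul (ε / 2))
    (Eventually.of_forall fun y => ?_)) ?_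
  · rw [← sub_mul, norm_mul, Complex.norm_real, Real.norm_of_nonneg (hP0 y)]
    by_cases hy : dist y a < δ
    · exact mul_le_mul_of_nonneg_right (by simpa [dist_eq_norm] using (H y hy).le) (hP0 y)
    · rw [dist_pi_lt_iff hδ] at hy
      push Not at hy
      obtain ⟨k, hk⟩ := hy
      have hz : ∏ k, lineKernel n (y k - a k) = 0 := by
        refine Finset.prod_eq_zero (Finset.mem_univ k) (lineKernel_eq_zero n ?_)
        rw [Real.dist_eq] at hk
        refine le_trans ?_ (hN.le.trans hk)
        apply one_div_le_one_div_of_le (by positivity)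
        have : (N : ℝ) ≤ n := by exact_mod_cast hn
        linarith
      simp [hz]
  · rw [integral_const_mul, hP]
    linarith

lemma tendsto_integral_mul_prod_kernelDiff [DecidableEq ι] {f : (ι → ℝ) → ℂ} (hf : Continuous f)
    (h x : ι → ℝ) :
    Tendsto (fun n => ∫ y, f y * ((∏ k, kernelDiff n (h k) (y k - x k) : ℝ) : ℂ)) atTop
      (𝓝 (mixedDiff h f x)) := by
  have heq : ∀ n, ∫ y, f y * ((∏ k, kernelDiff n (h k) (y k - x k) : ℝ) : ℂ) =
      ∑ S : Finset ι, (-1) ^ S.card *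
        ∫ y, f y * ((∏ k, lineKernel n (y k - (x + partialShift h S) k) : ℝ) : ℂ) := by
    intro n
    simp_rw [← integral_const_mul]
    rw [← integral_finsetSum]
    · congr 1
      ext y
      simp only [kernelDiff]
      rw [prod_sub_shift]
      push_cast
      rw [Finset.mul_sum]
      refine Finset.sum_congr rfl fun S _ => by ring
    · intro S _
      exact (integrable_mul_prod_test hf.locallyIntegrable
        (fun k => (isTestFun_lineKernel n).comp_sub _)).const_mul _
  simp_rw [heq]
  exact tendsto_finsetSum _ fun S _ => (tendsto_integral_mul_prod_lineKernel hf _).const_mul _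

end ApproximateIdentity

/-! ### Lᵖ bounds for mixed differences -/

/-- Young's inequality `‖D * K‖ₚ ≤ ‖K‖₁ ‖D‖ₚ`. -/
lemma lintegral_enorm_integral_mul_rpow_le {ι : Type*} [Fintype ι] {D K : (ι → ℝ) → ℂ}
    (hD : AEStronglyMeasurable D) (hK : Measurable K) {p : ℝ} (hp : 1 ≤ p) :
    ∫⁻ x, ‖∫ y, D y * K (y - x)‖ₑ ^ p ≤ (∫⁻ y, ‖K y‖ₑ) ^ p * ∫⁻ y, ‖D y‖ₑ ^ p := by
  have hp0 : 0 < p := zero_lt_one.trans_le hp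
  set κ := ∫⁻ y, ‖K y‖ₑ with hκ
  have hKx : ∀ x, ∫⁻ y, ‖K (y - x)‖ₑ = κ := fun x =>
    lintegral_sub_right_eq_self (fun y => ‖K y‖ₑ) x
  have hDm : AEMeasurable fun y => ‖D y‖ₑ ^ p := hD.enorm.pow_const p
  have hpt : ∀ x, ‖∫ y, D y * K (y - x)‖ₑ ^ p ≤
      κ ^ (p - 1) * ∫⁻ y, ‖D y‖ₑ ^ p * ‖K (y - x)‖ₑ := by
    intro x
    have hKm : Measurable fun y => ‖K (y - x)‖ₑ := (hK.comp (measurable_id.sub_const x)).enorm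
    -- Hölder for the splitting |D| |K| = (|D|^p |K|)^(1/p) |K|^(1 - 1/p); the case p = 1 is
    -- included.
    have hH := ENNReal.lintegral_mul_norm_pow_le (hDm.mul hKm.aemeasurable) hKm.aemeasurable
      (p := 1 / p) (q := 1 - 1 / p) (by positivity)
      (sub_nonneg.2 (by rw [div_le_one hp0]; exact hp)) (by ring)
    have h1 : ‖∫ y, D y * K (y - x)‖ₑ ≤
        (∫⁻ y, ‖D y‖ₑ ^ p * ‖K (y - x)‖ₑ) ^ (1 / p) * κ ^ (1 - 1 / p) := by
      rw [← hKx x]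
      refine (enorm_integral_le_lintegral_enorm _).trans (le_trans (le_of_eq ?_) hH)
      refine lintegral_congr fun y => ?_
      simp only [Pi.mul_apply]
      rw [ENNReal.mul_rpow_of_nonneg _ _ (by positivity), ← ENNReal.rpow_mul, mul_one_div_cancel
        hp0.ne', ENNReal.rpow_one, mul_assoc, ← ENNReal.rpow_add_of_nonneg _ _ (by positivity)
        (sub_nonneg.2 (by rw [div_le_one hp0]; exact hp)), enorm_mul]
      simp
    calc _ ≤ ((∫⁻ y, ‖D y‖ₑ ^ p * ‖K (y - x)‖ₑ) ^ (1 / p) * κ ^ (1 - 1 / p)) ^ p :=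
          ENNReal.rpow_le_rpow h1 hp0.le
      _ = _ := by
          rw [ENNReal.mul_rpow_of_nonneg _ _ hp0.le, ← ENNReal.rpow_mul, ← ENNReal.rpow_mul,
            one_div_mul_cancel hp0.ne', ENNReal.rpow_one, sub_mul, one_mul,
            one_div_mul_cancel hp0.ne', mul_comm]
  have hjoint : AEMeasurable (Function.uncurry fun x y : ι → ℝ => ‖D y‖ₑ ^ p * ‖K (y - x)‖ₑ)
      (volume.prod volume) := by
    refine AEMeasurable.mul ?_ ?_
    · exact hDm.comp_quasiMeasurePreserving Measure.quasiMeasurePreserving_snd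
    · exact (hK.comp (measurable_snd.sub measurable_fst)).enorm.aemeasurable
  calc _ ≤ ∫⁻ x, κ ^ (p - 1) * ∫⁻ y, ‖D y‖ₑ ^ p * ‖K (y - x)‖ₑ := lintegral_mono hpt
    _ = κ ^ (p - 1) * ∫⁻ x, ∫⁻ y, ‖D y‖ₑ ^ p * ‖K (y - x)‖ₑ :=
        lintegral_const_mul'' _ hjoint.lintegral_prod_right'
    _ = κ ^ (p - 1) * ∫⁻ y, ∫⁻ x, ‖D y‖ₑ ^ p * ‖K (y - x)‖ₑ := by
        rw [lintegral_lintegral_swap hjoint]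
    _ = κ ^ (p - 1) * ∫⁻ y, ‖D y‖ₑ ^ p * κ := by
        congr 1
        refine lintegral_congr fun y => ?_
        have hm : Measurable fun x => ‖K (y - x)‖ₑ :=
          (hK.comp (measurable_const.sub measurable_id)).enorm
        rw [lintegral_const_mul _ hm,
          lintegral_sub_left_eq_self (fun z => ‖K z‖ₑ) y]
    _ = κ ^ p * ∫⁻ y, ‖D y‖ₑ ^ p := by
        rw [lintegral_mul_const'' _ hDm, mul_comm (∫⁻ y, ‖D y‖ₑ ^ p), ← mul_assoc]
        congr 1
        nth_rw 2 [← ENNReal.rpow_one κ]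
        rw [← ENNReal.rpow_add_of_nonneg _ _ (by linarith) zero_le_one]
        simp

/-- After mollification, integration by parts in the variables of η turns the mixed difference, up
to sign, into an integral of `D η` against a translated tensor kernel whose L¹ norm is at most the
product of the factors h k and 2. Young's inequality bounds this uniformly in n, and Fatou's lemma
passes to the limit. -/
theorem lintegral_mixedDiff_rpow_le {d : ℕ} {f : (Fin d → ℝ) → ℂ} {C : ℝ}
    (hf : Continuous f) (hC : ∀ x, ‖f x‖ ≤ C)
    {D : Finset (Fin d) → (Fin d → ℝ) → ℂ} (hD : IsMixedDerivFamily f D)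
    (hloc : ∀ η, LocallyIntegrable (D η)) (η : Finset (Fin d)) {h : Fin d → ℝ}
    (hh : ∀ k, 0 ≤ h k) {p : ℝ} (hp : 1 ≤ p) :
    ∫⁻ x, ‖mixedDiff h f x‖ₑ ^ p ≤
      ENNReal.ofReal (∏ k, if k ∈ η then h k else 2) ^ p * ∫⁻ x, ‖D η x‖ₑ ^ p := by
  have hp0 : 0 < p := zero_lt_one.trans_le hp
  set κ : ℕ → Fin d → ℝ → ℝ := fun n k =>
    if k ∈ η then kernelMean n (h k) else kernelDiff n (h k) with hκ
  have hκt : ∀ n k, IsTestFun (κ n k) := by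
    intro n k
    simp only [hκ]
    split_ifs
    · exact isTestFun_kernelMean n (hh k)
    · exact isTestFun_kernelDiff n (h k)
  set G : ℕ → (Fin d → ℝ) → ℂ := fun n x =>
    ∫ y, f y * ((∏ k, kernelDiff n (h k) (y k - x k) : ℝ) : ℂ) with hG
  have hGD : ∀ n x, ‖G n x‖ₑ = ‖∫ y, D η y * ((∏ k, κ n k ((y - x) k) : ℝ) : ℂ)‖ₑ := by
    intro n x
    have hw := integral_mul_prod_deriv hf hC hD hloc η (fun k t => κ n k (t - x k))
      (fun k => (hκt n k).comp_sub _) ?_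
    · have : G n x = (-1) ^ η.card * ∫ y, D η y * ((∏ k, κ n k ((y - x) k) : ℝ) : ℂ) := by
        simp only [Pi.sub_apply]
        rw [← hw]
        simp only [hG]
        congr 1
        ext y
        congr 3
        ext k
        by_cases hk : k ∈ η
        · simp only [hk, if_true, hκ]
          rw [deriv_comp_sub_const, deriv_kernelMean]
        · simp [hk, hκ]
      rw [this, enorm_mul, enorm_pow]
      simp
    · intro k hk
      simp only [hκ, hk, if_true]
      obtain ⟨K, hK⟩ := exists_lipschitz_kernelMean n (h k)
      refine ⟨K, LipschitzWith.of_dist_le_mul fun s t => ?_⟩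
      simpa using hK.dist_le_mul (s - x k) (t - x k)
  have hbound : ∀ n, ∫⁻ x, ‖G n x‖ₑ ^ p ≤
      ENNReal.ofReal (∏ k, if k ∈ η then h k else 2) ^ p * ∫⁻ x, ‖D η x‖ₑ ^ p := by
    intro n
    simp_rw [hGD n]
    have hKm : Measurable fun y : Fin d → ℝ => ((∏ k, κ n k (y k) : ℝ) : ℂ) :=
      Complex.measurable_ofReal.comp (measurable_prod_test (hκt n))
    refine (lintegral_enorm_integral_mul_rpow_le (hloc η).aestronglyMeasurable hKm hp).trans ?_
    gcongr
    have hI : Integrable fun y : Fin d → ℝ => ((∏ k, κ n k (y k) : ℝ) : ℂ) :=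
      (Integrable.fintype_prod (fun k => (hκt n k).integrable)).ofReal
    rw [← ofReal_integral_norm_eq_lintegral_enorm hI]
    refine ENNReal.ofReal_le_ofReal ?_
    simp_rw [Complex.norm_real, Real.norm_eq_abs, Finset.abs_prod]
    rw [integral_fintype_prod_volume_eq_prod (fun k t => |κ n k t|)]
    refine Finset.prod_le_prod (fun k _ => integral_nonneg fun t => abs_nonneg _) fun k _ => ?_
    simp only [hκ]
    split_ifs
    · exact integral_kernelMean n (hh k)
    · exact integral_abs_kernelDiff_le n (h k)
  have hGm : ∀ n, Measurable (G n) := by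
    intro n
    refine (StronglyMeasurable.integral_prod_right (ν := volume)
      (f := fun x y : Fin d → ℝ => f y * ((∏ k, kernelDiff n (h k) (y k - x k) : ℝ) : ℂ))
      ?_).measurable
    refine Measurable.stronglyMeasurable (Measurable.mul (hf.measurable.comp measurable_snd) ?_)
    refine Complex.measurable_ofReal.comp (Finset.measurable_fun_prod _ fun k _ => ?_)
    refine (isTestFun_kernelDiff n (h k)).measurable.comp ?_
    exact ((measurable_pi_apply k).comp measurable_snd).sub
      ((measurable_pi_apply k).comp measurable_fst)
  calc ∫⁻ x, ‖mixedDiff h f x‖ₑ ^ p = ∫⁻ x, liminf (fun n => ‖G n x‖ₑ ^ p) atTop := by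
        refine lintegral_congr fun x => ?_
        have ht := tendsto_integral_mul_prod_kernelDiff hf h x
        exact ((ENNReal.continuous_rpow_const.tendsto _).comp
          (ht.enorm)).liminf_eq.symm
    _ ≤ liminf (fun n => ∫⁻ x, ‖G n x‖ₑ ^ p) atTop :=
        lintegral_liminf_le fun n => (hGm n).enorm.pow_const p
    _ ≤ _ := by
        refine (liminf_le_liminf (Eventually.of_forall hbound)).trans ?_
        simp

/-! ### Dyadic series -/

lemma ENNReal.tsum_pi_prod {d : ℕ} (b : Fin d → ℤ → ENNReal) :
    ∑' s : Fin d → ℤ, ∏ k, b k (s k) = ∏ k, ∑' n, b k n := by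
  induction d with
  | zero => simp
  | succ d ih =>
    rw [← (Fin.consEquiv fun _ : Fin (d + 1) => ℤ).tsum_eq]
    simp only [Fin.consEquiv_apply, Fin.prod_univ_succ, Fin.cons_zero, Fin.cons_succ]
    rw [ENNReal.tsum_prod (f := fun (a : ℤ) (s : Fin d → ℤ) =>
      b 0 a * ∏ k : Fin d, b k.succ (s k))]
    simp_rw [ENNReal.tsum_mul_left, ih (fun k => b k.succ)]
    rw [ENNReal.tsum_mul_right]

lemma ENNReal.tsum_int_ne_top {b : ℤ → ENNReal} (h1 : ∑' n : ℕ, b n ≠ ⊤)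
    (h2 : ∑' n : ℕ, b (-(n + 1 : ℤ)) ≠ ⊤) : ∑' n, b n ≠ ⊤ := by
  rw [(HasSum.of_nat_of_neg_add_one (f := b) ENNReal.summable.hasSum
    ENNReal.summable.hasSum).tsum_eq]
  exact ENNReal.add_ne_top.2 ⟨h1, h2⟩

lemma ENNReal.tsum_ofReal_geometric_ne_top {c r : ℝ} (hc : 0 ≤ c) (hr0 : 0 ≤ r) (hr : r < 1) :
    ∑' n : ℕ, ENNReal.ofReal (c * r ^ n) ≠ ⊤ := by
  have hs : Summable fun n : ℕ => c * r ^ n := (summable_geometric_of_lt_one hr0 hr).mul_left c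
  rw [← ENNReal.ofReal_tsum_of_nonneg (fun n => by positivity) hs]
  exact ENNReal.ofReal_ne_top

/-- The dyadic step `2⁻ⁿ / 4`. -/
noncomputable def dyadicStep (n : ℤ) : ℝ := (2 : ℝ) ^ (-n) / 4

lemma dyadicStep_pos (n : ℤ) : 0 < dyadicStep n := by unfold dyadicStep; positivity

lemma two_zpow_mul_dyadicStep_rpow (n : ℤ) (α : ℝ) :
    (2 : ℝ) ^ n * dyadicStep n ^ α = 4 ^ (-α) * 2 ^ ((1 - α) * n) := by
  rw [dyadicStep, Real.div_rpow (by positivity) (by norm_num), ← Real.rpow_intCast,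
    ← Real.rpow_intCast, ← Real.rpow_mul (by norm_num), Real.rpow_neg (by norm_num : (0 : ℝ) ≤ 4),
    div_eq_mul_inv, mul_left_comm, ← mul_assoc, mul_comm, ← Real.rpow_add (by norm_num)]
  congr 2
  push_cast
  ring

/-- The terms are a constant times 2^((1 - α) n / 2), decaying as n → +∞ if α > 1 and as n → -∞ if α
< 1. `P` selects the half-line on which the series is geometric and convergent. -/
lemma tsum_dyadic_ne_top {α : ℝ} {P : Prop} [Decidable P] (h1 : P → 1 < α) (h2 : ¬P → α < 1) :
    ∑' n : ℤ, (if (P ↔ 0 ≤ n) then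
      ENNReal.ofReal ((2 : ℝ) ^ n * dyadicStep n ^ α) ^ (1 / 2 : ℝ) else 0) ≠ ⊤ := by
  have hpow : ∀ n : ℤ, ENNReal.ofReal ((2 : ℝ) ^ n * dyadicStep n ^ α) ^ (1 / 2 : ℝ) =
      ENNReal.ofReal ((4 : ℝ) ^ (-α / 2) * 2 ^ ((1 - α) / 2 * n)) := by
    intro n
    rw [two_zpow_mul_dyadicStep_rpow, ENNReal.ofReal_rpow_of_nonneg (by positivity) (by norm_num),
      Real.mul_rpow (by positivity) (by positivity), ← Real.rpow_mul (by norm_num),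
      ← Real.rpow_mul (by norm_num)]
    congr 3 <;> ring
  simp_rw [hpow]
  by_cases hP : P
  · have hα := h1 hP
    refine ENNReal.tsum_int_ne_top ?_ ?_
    · simp only [hP, Nat.cast_nonneg, if_true]
      convert ENNReal.tsum_ofReal_geometric_ne_top (c := (4 : ℝ) ^ (-α / 2))
        (r := 2 ^ ((1 - α) / 2)) (by positivity) (by positivity)
        (Real.rpow_lt_one_of_one_lt_of_neg (by norm_num) (by linarith)) using 5 with n
      rw [Real.rpow_mul (by norm_num)]
      simp
    · have : ∀ n : ℕ, ¬ (0 : ℤ) ≤ -((n : ℤ) + 1) := fun n => by omega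
      simp only [hP, this, true_iff, if_false, tsum_zero]
      exact ENNReal.zero_ne_top
  · have hα := h2 hP
    refine ENNReal.tsum_int_ne_top ?_ ?_
    · simp [hP]
    · have : ∀ n : ℕ, ¬ (0 : ℤ) ≤ -((n : ℤ) + 1) := fun n => by omega
      simp only [hP, this, if_true]
      -- The negative half-line is indexed by -(n + 1), so one extra ratio goes into the constant.
      convert ENNReal.tsum_ofReal_geometric_ne_top
        (c := (4 : ℝ) ^ (-α / 2) * 2 ^ (-((1 - α) / 2)))
        (r := 2 ^ (-((1 - α) / 2))) (by positivity) (by positivity)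
        (Real.rpow_lt_one_of_one_lt_of_neg (by norm_num) (by linarith)) using 4 with n
      rw [mul_assoc, ← Real.rpow_natCast, ← Real.rpow_mul (by norm_num),
        ← Real.rpow_add (by norm_num)]
      congr 2
      push_cast
      ring

/-! ### From Lᵖ to L² by interpolation -/

section
variable {α : Type*} [MeasurableSpace α] {μ : Measure α} {g : α → ℂ}

lemma lintegral_sq_le_of_bounded {p M : ℝ} (hp0 : 0 ≤ p) (hp2 : p ≤ 2) (hM : ∀ x, ‖g x‖ ≤ M) :
    ∫⁻ x, ‖g x‖ₑ ^ (2 : ℝ) ∂μ ≤ ENNReal.ofReal M ^ (2 - p) * ∫⁻ x, ‖g x‖ₑ ^ p ∂μ := by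
  rw [← lintegral_const_mul' _ _ (ENNReal.rpow_ne_top_of_nonneg (by linarith)
    ENNReal.ofReal_ne_top)]
  refine lintegral_mono fun x => ?_
  have h : ‖g x‖ₑ ^ (2 : ℝ) = ‖g x‖ₑ ^ (2 - p) * ‖g x‖ₑ ^ p := by
    rw [← ENNReal.rpow_add_of_nonneg _ _ (by linarith) hp0]
    congr 1
    ring
  rw [h]
  gcongr
  rw [← ofReal_norm]
  exact ENNReal.ofReal_le_ofReal (hM x)

/-- Hölder for 2 = p θ + q (1 - θ) with θ = (q - 2)/(q - p). Both orders of p and q are allowed,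
because the exponent of f may lie on either side of 2. -/
lemma lintegral_sq_le_interpolate {p q : ℝ} (hg : AEMeasurable g μ)
    (hpq : p < 2 ∧ 2 < q ∨ q < 2 ∧ 2 < p) (hp0 : 0 < p) (hq0 : 0 < q) :
    ∫⁻ x, ‖g x‖ₑ ^ (2 : ℝ) ∂μ ≤ (∫⁻ x, ‖g x‖ₑ ^ p ∂μ) ^ ((q - 2) / (q - p)) *
      (∫⁻ x, ‖g x‖ₑ ^ q ∂μ) ^ ((2 - p) / (q - p)) := by
  have hne : q - p ≠ 0 := by
    rcases hpq with h | h <;> intro h0 <;> linarith [h.1, h.2]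
  have ha : 0 ≤ (q - 2) / (q - p) := by
    rcases hpq with h | h
    · exact div_nonneg (by linarith [h.2]) (by linarith [h.1, h.2])
    · exact div_nonneg_of_nonpos (by linarith [h.1]) (by linarith [h.1, h.2])
  have hb : 0 ≤ (2 - p) / (q - p) := by
    rcases hpq with h | h
    · exact div_nonneg (by linarith [h.1]) (by linarith [h.1, h.2])
    · exact div_nonneg_of_nonpos (by linarith [h.2]) (by linarith [h.1, h.2])
  have hH := ENNReal.lintegral_mul_norm_pow_le (hg.enorm.pow_const p) (hg.enorm.pow_const q)
    ha hb (by field_simp; ring)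
  refine le_trans (le_of_eq (lintegral_congr fun x => ?_)) hH
  rw [← ENNReal.rpow_mul, ← ENNReal.rpow_mul, ← ENNReal.rpow_add_of_nonneg _ _
    (mul_nonneg hp0.le ha) (mul_nonneg hq0.le hb)]
  congr 1
  field_simp
  ring

end

section
variable {ι : Type*} [Fintype ι] [DecidableEq ι]

lemma continuous_mixedDiff {f : (ι → ℝ) → ℂ} (hf : Continuous f) (h : ι → ℝ) :
    Continuous (mixedDiff h f) := by
  unfold mixedDiff
  fun_prop

lemma norm_mixedDiff_le {f : (ι → ℝ) → ℂ} {C : ℝ} (hC : ∀ x, ‖f x‖ ≤ C) (h x : ι → ℝ) :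
    ‖mixedDiff h f x‖ ≤ Fintype.card (Finset ι) * C := by
  unfold mixedDiff
  refine (norm_sum_le _ _).trans ?_
  have : ∀ S ∈ (Finset.univ : Finset (Finset ι)),
      ‖(-1) ^ S.card * f (x + partialShift h S)‖ ≤ C := by
    intro S _
    rw [norm_mul, norm_pow, norm_neg, norm_one, one_pow, one_mul]
    exact hC _
  refine (Finset.sum_le_sum this).trans ?_
  simp

end

lemma prod_rpow_rpow {ι : Type*} [Fintype ι] {h : ι → ℝ} (hh : ∀ k, 0 < h k) (α : ι → ℝ) (c : ℝ) :
    (∏ k, h k ^ α k) ^ c = ∏ k, h k ^ (α k * c) := by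
  rw [← Real.finsetProd_rpow _ _ fun k _ => (Real.rpow_pos_of_pos (hh k) _).le]
  exact Finset.prod_congr rfl fun k _ => (Real.rpow_mul (hh k).le _ _).symm

lemma exists_lintegral_mixedDiff_rpow_le {d : ℕ} {f : (Fin d → ℝ) → ℂ} {C : ℝ}
    (hf : Continuous f) (hC : ∀ x, ‖f x‖ ≤ C)
    {D : Finset (Fin d) → (Fin d → ℝ) → ℂ} (hD : IsMixedDerivFamily f D)
    (hloc : ∀ η, LocallyIntegrable (D η)) (η : Finset (Fin d)) {p : ℝ} (hp : 1 ≤ p)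
    (hfin : ∫⁻ x, ‖D η x‖ₑ ^ p ≠ ⊤) :
    ∃ B : ENNReal, B ≠ ⊤ ∧ ∀ h : Fin d → ℝ, (∀ k, 0 < h k) →
      ∫⁻ x, ‖mixedDiff h f x‖ₑ ^ p ≤
        B * ENNReal.ofReal (∏ k, h k ^ (if k ∈ η then p else 0)) := by
  have hp0 : 0 ≤ p := by linarith
  refine ⟨ENNReal.ofReal (2 ^ d) ^ p * ∫⁻ x, ‖D η x‖ₑ ^ p,
    ENNReal.mul_ne_top (ENNReal.rpow_ne_top_of_nonneg hp0 ENNReal.ofReal_ne_top) hfin,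
    fun h hh => ?_⟩
  refine (lintegral_mixedDiff_rpow_le hf hC hD hloc η (fun k => (hh k).le) hp).trans ?_
  rw [mul_right_comm]
  gcongr
  have h1 : ∏ k, h k ^ (if k ∈ η then p else 0) =
      (∏ k, h k ^ (if k ∈ η then (1 : ℝ) else 0)) ^ p := by
    rw [prod_rpow_rpow hh]
    refine Finset.prod_congr rfl fun k _ => ?_
    split_ifs <;> simp
  have hpos : 0 ≤ ∏ k, h k ^ (if k ∈ η then (1 : ℝ) else 0) :=
    Finset.prod_nonneg fun k _ => (Real.rpow_pos_of_pos (hh k) _).le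
  rw [h1, ← ENNReal.ofReal_rpow_of_nonneg hpos hp0, ← ENNReal.mul_rpow_of_nonneg _ _ hp0,
    ← ENNReal.ofReal_mul (by positivity)]
  refine ENNReal.rpow_le_rpow (ENNReal.ofReal_le_ofReal ?_) hp0
  have h2 : (2 : ℝ) ^ d = ∏ _k : Fin d, 2 := by simp
  rw [h2, ← Finset.prod_mul_distrib]
  refine Finset.prod_le_prod (fun k _ => ?_) fun k _ => ?_
  · split_ifs
    · exact (hh k).le
    · norm_num
  · split_ifs
    · simp only [Real.rpow_one]; linarith [hh k]
    · simp

/-- The `L²` norms of the mixed differences decay faster than `√(h k)` in the variables `k ∈ S`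
and grow slower than `√(h k)` in the other ones. -/
theorem exists_lintegral_mixedDiff_sq_le {d : ℕ} (hd : 0 < d) {f : (Fin d → ℝ) → ℂ} {C : ℝ}
    (hf : Continuous f) (hC : ∀ x, ‖f x‖ ≤ C)
    {D : Finset (Fin d) → (Fin d → ℝ) → ℂ} (hD : IsMixedDerivFamily f D)
    (hloc : ∀ η, LocallyIntegrable (D η)) {p : Finset (Fin d) → ℝ} (hp_zero : 1 ≤ p ∅)
    (hp : ∀ η, η ≠ ∅ → 1 < p η) (hfin : ∀ η, ∫⁻ x, ‖D η x‖ₑ ^ p η ≠ ⊤)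
    (hcond : ∀ η, η ≠ ∅ → 1 < 1 / p ∅ + 1 / p η) (S : Finset (Fin d)) :
    ∃ (B : ENNReal) (α : Fin d → ℝ), B ≠ ⊤ ∧ (∀ k ∈ S, 1 < α k) ∧ (∀ k ∉ S, α k < 1) ∧
      ∀ h : Fin d → ℝ, (∀ k, 0 < h k) →
        ∫⁻ x, ‖mixedDiff h f x‖ₑ ^ (2 : ℝ) ≤ B * ENNReal.ofReal (∏ k, h k ^ α k) := by
  have hp1 : ∀ η, 1 ≤ p η := fun η => by
    rcases eq_or_ne η ∅ with rfl | h
    · exact hp_zero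
    · exact (hp η h).le
  -- Equivalently (p ∅ - 1)(p η - 1) < 1, so p ∅ and p η cannot both be at least 2.
  have hcond' : ∀ η, η ≠ ∅ → p ∅ * p η < p ∅ + p η := fun η hη => by
    have h := hcond η hη
    have h0 : 0 < p ∅ := by linarith
    have h1 : 0 < p η := by linarith [hp1 η]
    rw [div_add_div _ _ h0.ne' h1.ne', lt_div_iff₀ (mul_pos h0 h1)] at h
    linarith
  have hbound := fun η => exists_lintegral_mixedDiff_rpow_le hf hC hD hloc η (hp1 η) (hfin η)
  have hmeas : ∀ h, AEMeasurable (mixedDiff h f) := fun h =>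
    (continuous_mixedDiff hf h).measurable.aemeasurable
  have interp : ∀ η, (p ∅ < 2 ∧ 2 < p η ∨ p η < 2 ∧ 2 < p ∅) →
      ∃ B : ENNReal, B ≠ ⊤ ∧ ∀ h : Fin d → ℝ, (∀ k, 0 < h k) →
        ∫⁻ x, ‖mixedDiff h f x‖ₑ ^ (2 : ℝ) ≤ B * ENNReal.ofReal (∏ k, h k ^
          ((if k ∈ η then p η else 0) * ((2 - p ∅) / (p η - p ∅)))) := by
    intro η hη
    obtain ⟨B0, hB0, h0⟩ := hbound ∅
    obtain ⟨B1, hB1, h1⟩ := hbound η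
    have ha : 0 ≤ (p η - 2) / (p η - p ∅) := by
      rcases hη with h | h
      · exact div_nonneg (by linarith [h.2]) (by linarith [h.1, h.2])
      · exact div_nonneg_of_nonpos (by linarith [h.1]) (by linarith [h.1, h.2])
    have hb : 0 ≤ (2 - p ∅) / (p η - p ∅) := by
      rcases hη with h | h
      · exact div_nonneg (by linarith [h.1]) (by linarith [h.1, h.2])
      · exact div_nonneg_of_nonpos (by linarith [h.2]) (by linarith [h.1, h.2])
    refine ⟨B0 ^ ((p η - 2) / (p η - p ∅)) * B1 ^ ((2 - p ∅) / (p η - p ∅)),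
      ENNReal.mul_ne_top (ENNReal.rpow_ne_top_of_nonneg ha hB0)
        (ENNReal.rpow_ne_top_of_nonneg hb hB1), fun h hh => ?_⟩
    refine (lintegral_sq_le_interpolate (hmeas h) hη (by linarith [hp1 ∅])
      (by linarith [hp1 η])).trans ?_
    rw [mul_assoc]
    refine mul_le_mul' (ENNReal.rpow_le_rpow ?_ ha) ?_
    · simpa using h0 h hh
    · refine (ENNReal.rpow_le_rpow (h1 h hh) hb).trans (le_of_eq ?_)
      rw [ENNReal.mul_rpow_of_nonneg _ _ hb, ENNReal.ofReal_rpow_of_nonneg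
        (Finset.prod_nonneg fun k _ => (Real.rpow_pos_of_pos (hh k) _).le) hb, prod_rpow_rpow hh]
  -- If p S ≤ 2, boundedness of f is enough: the exponents are p S on `S` and 0 elsewhere.
  rcases le_or_gt (p S) 2 with hS | hS
  · obtain ⟨B, hB, h1⟩ := hbound S
    refine ⟨ENNReal.ofReal (Fintype.card (Finset (Fin d)) * C) ^ (2 - p S) * B,
      fun k => if k ∈ S then p S else 0, ENNReal.mul_ne_top
      (ENNReal.rpow_ne_top_of_nonneg (by linarith) ENNReal.ofReal_ne_top) hB, fun k hk => ?_,
      fun k hk => ?_, fun h hh => ?_⟩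
    · simpa [hk] using hp S (Finset.ne_empty_of_mem hk)
    · simp [hk]
    · refine (lintegral_sq_le_of_bounded (by linarith [hp1 S]) hS
        (norm_mixedDiff_le hC h)).trans ?_
      rw [mul_assoc]
      exact mul_le_mul_right (h1 h hh) _
  -- Now p ∅ > 2 and every exponent has to be below 1. Interpolation is with the full mixed
  -- derivative, and the exponent p_η (p_0 - 2)/(p_0 - p_η) is below 1 precisely when p_0 p_η < p_0
  -- + p_η.
  · rcases eq_or_ne S ∅ with rfl | hne
    · have hu : (Finset.univ : Finset (Fin d)) ≠ ∅ :=
        Finset.ne_empty_of_mem (Finset.mem_univ (⟨0, hd⟩ : Fin d))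
      have hc := hcond' _ hu
      have hq : p Finset.univ < 2 := by nlinarith [hp _ hu]
      obtain ⟨B, hB, h1⟩ := interp Finset.univ (Or.inr ⟨hq, hS⟩)
      refine ⟨B, _, hB, by simp, fun k _ => ?_, h1⟩
      simp only [Finset.mem_univ, if_true]
      rw [mul_div_assoc', div_lt_one_of_neg (by linarith)]
      nlinarith
    -- Now p S > 2 > p ∅, and p_S (2 - p_0)/(p_S - p_0) exceeds 1 by the same inequality.
    · have hc := hcond' _ hne
      have hq : p ∅ < 2 := by nlinarith [hp1 ∅]
      obtain ⟨B, hB, h1⟩ := interp S (Or.inl ⟨hq, hS⟩)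
      refine ⟨B, _, hB, fun k hk => ?_, fun k hk => ?_, h1⟩
      · simp only [hk, if_true]
        rw [mul_div_assoc', one_lt_div (by linarith)]
        nlinarith
      · simp [hk]

/-- Split ℤᵈ into orthants according to S = {k | 0 ≤ s k} and use on each the L² bound made for that
`S`. The resulting terms factor over the coordinates, so each orthant contributes a product of
convergent geometric series. -/
theorem tsum_dyadic_mixedDiff_ne_top {d : ℕ} (hd : 0 < d) {f : (Fin d → ℝ) → ℂ} {C : ℝ}
    (hf : Continuous f) (hC : ∀ x, ‖f x‖ ≤ C)
    {D : Finset (Fin d) → (Fin d → ℝ) → ℂ} (hD : IsMixedDerivFamily f D)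
    (hloc : ∀ η, LocallyIntegrable (D η)) {p : Finset (Fin d) → ℝ} (hp_zero : 1 ≤ p ∅)
    (hp : ∀ η, η ≠ ∅ → 1 < p η) (hfin : ∀ η, ∫⁻ x, ‖D η x‖ₑ ^ p η ≠ ⊤)
    (hcond : ∀ η, η ≠ ∅ → 1 < 1 / p ∅ + 1 / p η) :
    ∑' s : Fin d → ℤ, ENNReal.ofReal (∏ k, (2 : ℝ) ^ s k) ^ (1 / 2 : ℝ) *
      (∫⁻ x, ‖mixedDiff (fun k => dyadicStep (s k)) f x‖ₑ ^ (2 : ℝ)) ^ (1 / 2 : ℝ) ≠ ⊤ := by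
  choose B α hB h1 h2 hbd using
    exists_lintegral_mixedDiff_sq_le hd hf hC hD hloc hp_zero hp hfin hcond
  set b : Finset (Fin d) → Fin d → ℤ → ENNReal := fun S k n => if (k ∈ S ↔ 0 ≤ n) then
      ENNReal.ofReal ((2 : ℝ) ^ n * dyadicStep n ^ α S k) ^ (1 / 2 : ℝ) else 0 with hb
  have hle : ∀ s : Fin d → ℤ, ENNReal.ofReal (∏ k, (2 : ℝ) ^ s k) ^ (1 / 2 : ℝ) *
      (∫⁻ x, ‖mixedDiff (fun k => dyadicStep (s k)) f x‖ₑ ^ (2 : ℝ)) ^ (1 / 2 : ℝ) ≤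
      ∑ S, B S ^ (1 / 2 : ℝ) * ∏ k, b S k (s k) := by
    intro s
    set S : Finset (Fin d) := Finset.univ.filter fun k => 0 ≤ s k with hS
    refine le_trans ?_ (Finset.single_le_sum (f := fun S => B S ^ (1 / 2 : ℝ) * ∏ k, b S k (s k))
      (fun _ _ => zero_le) (Finset.mem_univ S))
    have hmem : ∀ k, (k ∈ S ↔ 0 ≤ s k) := fun k => by simp [hS]
    simp only [hb, hmem, if_true]
    rw [ENNReal.prod_rpow_of_nonneg (show (0 : ℝ) ≤ 1 / 2 by norm_num),
      ← ENNReal.ofReal_prod_of_nonneg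
      (fun k _ => mul_nonneg (show (0 : ℝ) ≤ 2 ^ s k by positivity)
        (Real.rpow_pos_of_pos (dyadicStep_pos _) _).le),
      Finset.prod_mul_distrib, ENNReal.ofReal_mul (show (0 : ℝ) ≤ ∏ k, (2 : ℝ) ^ s k by positivity),
      ENNReal.mul_rpow_of_nonneg _ _ (show (0 : ℝ) ≤ 1 / 2 by norm_num), mul_left_comm,
      ← ENNReal.mul_rpow_of_nonneg (B S) _ (show (0 : ℝ) ≤ 1 / 2 by norm_num)]
    refine mul_le_mul_right (ENNReal.rpow_le_rpow ?_ (show (0 : ℝ) ≤ 1 / 2 by norm_num)) _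
    exact hbd S _ fun k => dyadicStep_pos _
  refine ne_top_of_le_ne_top ?_ (ENNReal.tsum_le_tsum hle)
  rw [Summable.tsum_finsetSum fun _ _ => ENNReal.summable]
  refine ENNReal.sum_ne_top.2 fun S _ => ?_
  rw [ENNReal.tsum_mul_left, ENNReal.tsum_pi_prod]
  refine ENNReal.mul_ne_top (ENNReal.rpow_ne_top_of_nonneg (by norm_num) (hB S)) ?_
  refine ENNReal.prod_ne_top fun k _ => ?_
  exact tsum_dyadic_ne_top (h1 S k) (h2 S k)

/-! ### The Fourier transform on L², tested against Schwartz functions -/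

section L2Fourier
variable {V : Type*} [NormedAddCommGroup V] [InnerProductSpace ℝ V]

/-- The character `ξ ↦ exp (2 π i ⟪a, ξ⟫)`. -/
noncomputable def planeWave (a ξ : V) : ℂ := Real.fourierChar (inner ℝ a ξ)

lemma norm_planeWave (a ξ : V) : ‖planeWave a ξ‖ = 1 := Circle.norm_coe _

lemma continuous_planeWave (a : V) : Continuous (planeWave a) := by
  unfold planeWave
  exact continuous_subtype_val.comp (Real.continuous_fourierChar.comp (by fun_prop))

variable [FiniteDimensional ℝ V] [MeasurableSpace V] [BorelSpace V]

/-- `v` is the Fourier transform of `u`, both being square integrable. -/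
structure IsL2Fourier (u v : V → ℂ) : Prop where
  memLp_left : MemLp u 2
  memLp_right : MemLp v 2
  integral_eq : ∀ φ : 𝓢(V, ℂ), ∫ ξ, φ ξ * v ξ = ∫ x, (𝓕 φ : 𝓢(V, ℂ)) x * u x

lemma exists_isL2Fourier {u : V → ℂ} (hu : MemLp u 2) :
    ∃ v, IsL2Fourier u v ∧ eLpNorm v 2 volume = eLpNorm u 2 volume := by
  set U : Lp ℂ 2 (volume : Measure V) := hu.toLp u with hU
  refine ⟨(𝓕 U : Lp ℂ 2 (volume : Measure V)), ⟨hu, Lp.memLp _, fun φ => ?_⟩, ?_⟩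
  · have h := congrArg (fun T : 𝓢'(V, ℂ) => T φ) (Lp.fourier_toTemperedDistribution_eq U)
    simp only [TemperedDistribution.fourier_apply, Lp.toTemperedDistribution_apply,
      smul_eq_mul] at h
    rw [← h]
    refine integral_congr_ae ?_
    filter_upwards [hu.coeFn_toLp] with x hx
    rw [hx]
  · have h := Lp.norm_fourier_eq U
    rw [Lp.norm_def, Lp.norm_def, ENNReal.toReal_eq_toReal_iff' (Lp.eLpNorm_ne_top _)
      (Lp.eLpNorm_ne_top _)] at h
    rw [h]
    exact eLpNorm_congr_ae hu.coeFn_toLp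

lemma ae_eq_zero_of_integral_schwartz {w : V → ℂ} (hw : LocallyIntegrable w)
    (h : ∀ φ : 𝓢(V, ℂ), ∫ x, φ x * w x = 0) : w =ᵐ[volume] 0 := by
  refine ae_eq_zero_of_integral_contDiff_smul_eq_zero hw fun g hg hc => ?_
  have h1 : HasCompactSupport (Complex.ofRealCLM ∘ g) := hc.comp_left rfl
  have h2 : ContDiff ℝ ∞ (Complex.ofRealCLM ∘ g) := by fun_prop
  have h3 := h (h1.toSchwartzMap h2)
  rw [← h3]
  refine integral_congr_ae (Eventually.of_forall fun x => ?_)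
  simp [Complex.real_smul]

lemma integrable_schwartz_mul {v : V → ℂ} (hv : MemLp v 2) (φ : 𝓢(V, ℂ)) :
    Integrable fun ξ => φ ξ * v ξ := (φ.memLp 2).integrable_mul hv

lemma continuous_fourierInv {v : V → ℂ} (hv : Integrable v) : Continuous (𝓕⁻ v) := by
  rw [← Real.Lp.fourierTransformInv_toLp (memLp_one_iff_integrable.2 hv)]
  exact BoundedContinuousFunction.continuous _

lemma tendsto_fourierInv_cocompact (v : V → ℂ) : Tendsto (𝓕⁻ v) (cocompact V) (𝓝 0) := by
  have h : 𝓕⁻ v = (fun w => ∫ x, Real.fourierChar (-inner ℝ x w) • v x) ∘ (fun w => -w) := by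
    ext w
    simp [Real.fourierInv_eq]
  rw [h]
  exact (tendsto_integral_exp_inner_smul_cocompact v).comp
    (Homeomorph.neg V).isClosedEmbedding.tendsto_cocompact

/-- Symmetry of the Fourier transform under the integral pairing, after the reflection ξ ↦ -ξ. -/
lemma integral_fourierInv_schwartz_mul {v : V → ℂ} (hv : Integrable v) (φ : 𝓢(V, ℂ)) :
    ∫ ξ, (𝓕⁻ φ : 𝓢(V, ℂ)) ξ * v ξ = ∫ x, φ x * 𝓕⁻ v x := by
  have h1 := VectorFourier.integral_bilin_fourierIntegral_eq_flip (e := Real.fourierChar)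
    (L := innerₗ V) (μ := (volume : Measure V)) (ν := (volume : Measure V)) (f := φ)
    (g := fun ξ => v (-ξ)) (ContinuousLinearMap.mul ℂ ℂ) Real.continuous_fourierChar
    continuous_inner φ.integrable hv.comp_neg
  rw [← integral_neg_eq_self]
  calc _ = ∫ ξ, 𝓕 (φ : V → ℂ) ξ * v (-ξ) := by
        congr 1
        ext ξ
        rw [SchwartzMap.fourierInv_coe, Real.fourierInv_eq_fourier_neg, neg_neg]
    _ = ∫ x, φ x * 𝓕 (fun ξ => v (-ξ)) x := by
        rw [flip_innerₗ] at h1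
        exact h1
    _ = _ := by rw [Real.fourierInv_eq_fourier_comp_neg]

namespace IsL2Fourier
variable {u v u' v' : V → ℂ}

lemma unique_right (h : IsL2Fourier u v) (h' : IsL2Fourier u v') : v =ᵐ[volume] v' := by
  have hz := ae_eq_zero_of_integral_schwartz
    ((h.memLp_right.sub h'.memLp_right).locallyIntegrable one_le_two) fun φ => by
      simp only [Pi.sub_apply, mul_sub]
      rw [integral_sub (integrable_schwartz_mul h.memLp_right φ)
        (integrable_schwartz_mul h'.memLp_right φ), h.integral_eq, h'.integral_eq, sub_self]
  filter_upwards [hz] with x hx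
  simpa [sub_eq_zero] using hx

lemma sum_const_mul {κ : Type*} (s : Finset κ) (c : κ → ℂ) {u v : κ → V → ℂ}
    (h : ∀ i ∈ s, IsL2Fourier (u i) (v i)) :
    IsL2Fourier (fun x => ∑ i ∈ s, c i * u i x) (fun ξ => ∑ i ∈ s, c i * v i ξ) := by
  refine ⟨memLp_finsetSum _ fun i hi => (h i hi).memLp_left.const_mul _,
    memLp_finsetSum _ fun i hi => (h i hi).memLp_right.const_mul _, fun φ => ?_⟩
  simp_rw [Finset.mul_sum, mul_left_comm _ (c _)]
  rw [integral_finsetSum _ fun i hi =>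
      (integrable_schwartz_mul (h i hi).memLp_right φ).const_mul (c i),
    integral_finsetSum _ fun i hi =>
      (integrable_schwartz_mul (h i hi).memLp_left (𝓕 φ)).const_mul (c i)]
  refine Finset.sum_congr rfl fun i hi => ?_
  rw [integral_const_mul, integral_const_mul, (h i hi).integral_eq]

lemma comp_add_right (h : IsL2Fourier u v) (a : V) :
    IsL2Fourier (fun x => u (x + a)) (fun ξ => planeWave a ξ * v ξ) := by
  refine ⟨h.memLp_left.comp_measurePreserving (measurePreserving_add_right volume a), ?_,
    fun φ => ?_⟩
  · refine h.memLp_right.of_le ?_ (Eventually.of_forall fun ξ => ?_)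
    · exact (continuous_planeWave a).aestronglyMeasurable.mul h.memLp_right.1
    · rw [norm_mul, norm_planeWave, one_mul]
  -- Translating u back onto the test side translates the transform of φ, that is, multiplies φ by a
  -- plane wave. Defining ψ as an inverse transform makes it a Schwartz function from the start.
  · set ψ : 𝓢(V, ℂ) := 𝓕⁻ (SchwartzMap.compSubConstCLM ℂ a (𝓕 φ : 𝓢(V, ℂ))) with hψ
    have h1 : ∀ ξ, ψ ξ = φ ξ * planeWave a ξ := by
      intro ξ
      have h3 : φ ξ = (𝓕⁻ (𝓕 φ) : 𝓢(V, ℂ)) ξ := by rw [FourierTransform.fourierInv_fourier_eq]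
      rw [hψ, h3, SchwartzMap.fourierInv_coe, SchwartzMap.fourierInv_coe, Real.fourierInv_eq,
        Real.fourierInv_eq, ← integral_add_right_eq_self _ a, ← integral_mul_const]
      congr 1
      ext x
      rw [SchwartzMap.compSubConstCLM_apply, add_sub_cancel_right, inner_add_left,
        AddChar.map_add_eq_mul, planeWave, Circle.smul_def, Circle.smul_def, Circle.coe_mul,
        smul_eq_mul, smul_eq_mul]
      ring
    have h2 : 𝓕 ψ = SchwartzMap.compSubConstCLM ℂ a (𝓕 φ : 𝓢(V, ℂ)) :=
      FourierTransform.fourier_fourierInv_eq _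
    calc ∫ ξ, φ ξ * (planeWave a ξ * v ξ) = ∫ ξ, ψ ξ * v ξ := by
          simp_rw [h1, mul_assoc]
      _ = ∫ x, (𝓕 φ : 𝓢(V, ℂ)) (x - a) * u x := by
          rw [h.integral_eq, h2]
          rfl
      _ = ∫ x, (𝓕 φ : 𝓢(V, ℂ)) x * u (x + a) := by
          rw [← integral_add_right_eq_self (fun x => (𝓕 φ : 𝓢(V, ℂ)) (x - a) * u x) a]
          simp only [add_sub_cancel_right]

/-- Fourier inversion for square integrable functions with integrable Fourier transform. -/
lemma ae_eq_fourierInv (h : IsL2Fourier u v) (hv : Integrable v) : u =ᵐ[volume] 𝓕⁻ v := by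
  have hc := continuous_fourierInv hv
  have hint : ∀ φ : 𝓢(V, ℂ), Integrable fun x => φ x * 𝓕⁻ v x := fun φ =>
    φ.integrable.mul_bdd (c := ∫ ξ, ‖v ξ‖) hc.aestronglyMeasurable
      (Eventually.of_forall fun x => by
        rw [Real.fourierInv_eq]
        refine (norm_integral_le_integral_norm _).trans (le_of_eq ?_)
        simp_rw [Circle.norm_smul])
  have hz := ae_eq_zero_of_integral_schwartz (w := u - 𝓕⁻ v)
    ((h.memLp_left.locallyIntegrable one_le_two).sub hc.locallyIntegrable) fun φ => by
      simp only [Pi.sub_apply, mul_sub]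
      rw [integral_sub (integrable_schwartz_mul h.memLp_left φ) (hint φ), sub_eq_zero]
      have h1 := h.integral_eq (𝓕⁻ φ)
      rw [FourierTransform.fourier_fourierInv_eq] at h1
      rw [← h1, integral_fourierInv_schwartz_mul hv]
  filter_upwards [hz] with x hx
  simpa [sub_eq_zero] using hx

end IsL2Fourier

end L2Fourier

/-! ### The symbol of the mixed difference and the dyadic blocks -/

section Euclidean
variable {d : ℕ}

/-- The mixed difference on Euclidean space. -/
noncomputable def euclideanDiff (h : Fin d → ℝ) (u : EuclideanSpace ℝ (Fin d) → ℂ)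
    (x : EuclideanSpace ℝ (Fin d)) : ℂ :=
  ∑ S : Finset (Fin d), (-1) ^ S.card * u (x + WithLp.toLp 2 (partialShift h S))

/-- The Fourier symbol of the mixed difference. -/
noncomputable def diffSymbol (h : Fin d → ℝ) (ξ : EuclideanSpace ℝ (Fin d)) : ℂ :=
  ∑ S : Finset (Fin d), (-1) ^ S.card * planeWave (WithLp.toLp 2 (partialShift h S)) ξ

lemma euclideanDiff_comp_ofLp (h : Fin d → ℝ) (f : (Fin d → ℝ) → ℂ)
    (x : EuclideanSpace ℝ (Fin d)) :
    euclideanDiff h (fun x => f (WithLp.ofLp x)) x = mixedDiff h f (WithLp.ofLp x) := by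
  simp [euclideanDiff, mixedDiff]

lemma euclideanDiff_comm (h h' : Fin d → ℝ) (u : EuclideanSpace ℝ (Fin d) → ℂ) :
    euclideanDiff h (euclideanDiff h' u) = euclideanDiff h' (euclideanDiff h u) := by
  ext x
  unfold euclideanDiff
  simp_rw [Finset.mul_sum]
  rw [Finset.sum_comm]
  refine Finset.sum_congr rfl fun S _ => Finset.sum_congr rfl fun T _ => ?_
  rw [add_right_comm, mul_left_comm]

lemma planeWave_partialShift (h : Fin d → ℝ) (S : Finset (Fin d))
    (ξ : EuclideanSpace ℝ (Fin d)) :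
    planeWave (WithLp.toLp 2 (partialShift h S)) ξ =
      ∏ k ∈ S, (Real.fourierChar (h k * ξ k) : ℂ) := by
  have h1 : inner ℝ (WithLp.toLp 2 (partialShift h S)) ξ = ∑ k ∈ S, h k * ξ k := by
    simp [PiLp.inner_apply, partialShift, Finset.sum_ite_mem, mul_comm]
  rw [planeWave, h1]
  clear h1
  induction S using Finset.induction_on with
  | empty => simp
  | insert k S hk ih =>
    rw [Finset.sum_insert hk, Finset.prod_insert hk, AddChar.map_add_eq_mul, Circle.coe_mul, ih]

lemma diffSymbol_eq_prod (h : Fin d → ℝ) (ξ : EuclideanSpace ℝ (Fin d)) :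
    diffSymbol h ξ = ∏ k, (1 - (Real.fourierChar (h k * ξ k) : ℂ)) := by
  rw [Finset.prod_sub, Finset.powerset_univ, diffSymbol]
  refine Finset.sum_congr rfl fun S _ => ?_
  rw [planeWave_partialShift, Finset.prod_const_one, mul_one]

lemma continuous_diffSymbol (h : Fin d → ℝ) : Continuous (diffSymbol h) := by
  unfold diffSymbol
  exact continuous_finsetSum _ fun S _ => continuous_const.mul (continuous_planeWave _)

lemma norm_diffSymbol_le (h : Fin d → ℝ) (ξ : EuclideanSpace ℝ (Fin d)) :
    ‖diffSymbol h ξ‖ ≤ Fintype.card (Finset (Fin d)) := by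
  refine (norm_sum_le _ _).trans ?_
  simp [norm_planeWave]

lemma IsL2Fourier.euclideanDiff {u v : EuclideanSpace ℝ (Fin d) → ℂ} (huv : IsL2Fourier u v)
    (h : Fin d → ℝ) :
    IsL2Fourier (euclideanDiff h u) (fun ξ => diffSymbol h ξ * v ξ) := by
  have := IsL2Fourier.sum_const_mul (Finset.univ : Finset (Finset (Fin d)))
    (fun S => (-1) ^ S.card) fun S _ =>
      huv.comp_add_right (WithLp.toLp 2 (partialShift h S))
  refine (congrArg₂ IsL2Fourier rfl ?_).mp this
  ext ξ
  rw [diffSymbol, Finset.sum_mul]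
  simp_rw [mul_assoc]

/-- The angle 2π|t| lies in [π/2, π], where the cosine is nonpositive, so already the real part is
at least 1. The divisor 4 in `dyadicStep` is chosen to land in this range. -/
lemma one_le_norm_one_sub_fourierChar {t : ℝ} (h1 : 1 / 4 ≤ |t|) (h2 : |t| ≤ 1 / 2) :
    1 ≤ ‖1 - (Real.fourierChar t : ℂ)‖ := by
  refine le_trans ?_ (Complex.re_le_norm _)
  have hre : (1 - (Real.fourierChar t : ℂ)).re = 1 - Real.cos (2 * Real.pi * |t|) := by
    rw [Real.fourierChar_apply, Complex.sub_re, Complex.one_re, Complex.exp_ofReal_mul_I_re,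
      ← Real.cos_abs, abs_mul, abs_of_pos Real.two_pi_pos]
  rw [hre]
  have := Real.cos_nonpos_of_pi_div_two_le_of_le (x := 2 * Real.pi * |t|)
    (by nlinarith [Real.pi_pos]) (by nlinarith [Real.pi_pos])
  linarith

/-- The set of frequencies with `2 ^ s k ≤ |ξ k| < 2 ^ (s k + 1)`. -/
def dyadicBlock (s : Fin d → ℤ) : Set (EuclideanSpace ℝ (Fin d)) :=
  {ξ | ∀ k, (2 : ℝ) ^ s k ≤ |ξ k| ∧ |ξ k| < 2 ^ (s k + 1)}

lemma one_le_norm_diffSymbol {s : Fin d → ℤ} {ξ : EuclideanSpace ℝ (Fin d)}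
    (hξ : ξ ∈ dyadicBlock s) : 1 ≤ ‖diffSymbol (fun k => dyadicStep (s k)) ξ‖ := by
  rw [diffSymbol_eq_prod, norm_prod]
  refine Finset.one_le_prod fun k _ => ?_
  have h := hξ k
  have hs : (0 : ℝ) < 2 ^ s k := by positivity
  have habs : |dyadicStep (s k) * ξ k| = |ξ k| / 2 ^ s k / 4 := by
    rw [abs_mul, abs_of_pos (dyadicStep_pos _), dyadicStep, zpow_neg]
    field_simp
  apply one_le_norm_one_sub_fourierChar
  · rw [habs]
    gcongr
    rw [le_div_iff₀ hs, one_mul]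
    exact h.1
  · rw [habs, div_le_iff₀ (by norm_num), div_le_iff₀ hs]
    rw [zpow_add₀ (by norm_num), zpow_one] at h
    linarith [h.2]

lemma volume_dyadicBlock_le (s : Fin d → ℤ) :
    volume (dyadicBlock s) ≤ 4 ^ d * ENNReal.ofReal (∏ k, (2 : ℝ) ^ s k) := by
  have hsub : dyadicBlock s ⊆ WithLp.ofLp ⁻¹'
      (Set.univ.pi fun k => Icc (-(2 : ℝ) ^ (s k + 1)) (2 ^ (s k + 1))) := fun ξ hξ k _ =>
    abs_le.1 (hξ k).2.le
  refine (measure_mono hsub).trans ?_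
  rw [(PiLp.volume_preserving_ofLp (Fin d)).measure_preimage
    (MeasurableSet.univ_pi fun _ => measurableSet_Icc).nullMeasurableSet, volume_pi,
    Measure.pi_pi]
  simp_rw [Real.volume_Icc]
  rw [ENNReal.ofReal_prod_of_nonneg fun k _ => by positivity]
  have h4 : (4 : ENNReal) ^ d = ∏ _k : Fin d, 4 := by simp
  rw [h4, ← Finset.prod_mul_distrib]
  refine Finset.prod_le_prod' fun k _ => ?_
  rw [← ENNReal.ofReal_ofNat 4, ← ENNReal.ofReal_mul (by norm_num)]
  apply le_of_eq
  congr 1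
  rw [zpow_add₀ (by norm_num), zpow_one]
  ring

lemma measurableSet_dyadicBlock (s : Fin d → ℤ) : MeasurableSet (dyadicBlock s) := by
  have : dyadicBlock s = ⋂ k, {ξ : EuclideanSpace ℝ (Fin d) |
      (2 : ℝ) ^ s k ≤ |ξ k| ∧ |ξ k| < 2 ^ (s k + 1)} := by
    ext ξ
    simp [dyadicBlock]
  rw [this]
  refine MeasurableSet.iInter fun k => ?_
  have hc : Continuous fun ξ : EuclideanSpace ℝ (Fin d) => |ξ k| := by fun_prop
  exact (measurableSet_le measurable_const hc.measurable).inter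
    (measurableSet_lt hc.measurable measurable_const)

lemma ae_euclidean {P : (Fin d → ℝ) → Prop} (hP : ∀ᵐ y, P y) :
    ∀ᵐ ξ : EuclideanSpace ℝ (Fin d), P (WithLp.ofLp ξ) :=
  (PiLp.volume_preserving_ofLp (Fin d)).quasiMeasurePreserving.ae hP

lemma ae_mem_iUnion_dyadicBlock :
    ∀ᵐ ξ : EuclideanSpace ℝ (Fin d), ξ ∈ ⋃ s, dyadicBlock s := by
  filter_upwards [ae_euclidean ae_forall_ne_zero] with ξ hξ
  have : ∀ k, ∃ n : ℤ, (2 : ℝ) ^ n ≤ |ξ k| ∧ |ξ k| < 2 ^ (n + 1) := fun k =>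
    exists_mem_Ico_zpow (abs_pos.2 (hξ k)) one_lt_two
  choose s hs using this
  exact mem_iUnion.2 ⟨s, hs⟩

/-- The zero set is the countable union of the hyperplanes ξ_k = n / h_k. -/
lemma ae_diffSymbol_ne_zero {h : Fin d → ℝ} (hh : ∀ k, 0 < h k) :
    ∀ᵐ ξ : EuclideanSpace ℝ (Fin d), diffSymbol h ξ ≠ 0 := by
  have hae : ∀ᵐ y : Fin d → ℝ, ∀ k, ∀ n : ℤ, y k ≠ n / h k := by
    rw [ae_all_iff]
    intro k
    rw [ae_all_iff]
    intro n
    have := Measure.pi_hyperplane (fun _ : Fin d => (volume : Measure ℝ)) k (n / h k)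
    rw [ae_iff]
    simpa [volume_pi] using this
  filter_upwards [ae_euclidean hae] with ξ hξ
  rw [diffSymbol_eq_prod, Finset.prod_ne_zero_iff]
  intro k _ h0
  rw [sub_eq_zero, eq_comm, Real.fourierChar_apply, Complex.exp_eq_one_iff] at h0
  obtain ⟨n, hn⟩ := h0
  refine hξ k n ?_
  rw [eq_div_iff (hh k).ne']
  have h2 : ((2 * Real.pi * (h k * ξ k) : ℝ) : ℂ) = ((n * (2 * Real.pi) : ℝ) : ℂ) := by
    apply mul_right_cancel₀ Complex.I_ne_zero
    rw [hn]
    push_cast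
    ring
  have h3 := Complex.ofReal_injective h2
  have h4 := Real.pi_pos
  have h5 : 2 * Real.pi * (ξ k * h k - n) = 0 := by linarith
  rcases mul_eq_zero.1 h5 with h6 | h6
  · linarith
  · linarith

lemma fourierInv_planeWave_mul {V : Type*} [NormedAddCommGroup V] [InnerProductSpace ℝ V]
    [FiniteDimensional ℝ V] [MeasurableSpace V] [BorelSpace V] (a : V) (g : V → ℂ) (x : V) :
    𝓕⁻ (fun ξ => planeWave a ξ * g ξ) x = 𝓕⁻ g (x + a) := by
  rw [Real.fourierInv_eq, Real.fourierInv_eq]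
  congr 1
  ext ξ
  rw [inner_add_right, AddChar.map_add_eq_mul, Circle.smul_def, Circle.smul_def, Circle.coe_mul,
    planeWave, real_inner_comm a ξ, smul_eq_mul, smul_eq_mul, mul_assoc]

lemma fourierInv_diffSymbol_mul (h : Fin d → ℝ) {g : EuclideanSpace ℝ (Fin d) → ℂ}
    (hg : Integrable g) (x : EuclideanSpace ℝ (Fin d)) :
    𝓕⁻ (fun ξ => diffSymbol h ξ * g ξ) x = euclideanDiff h (𝓕⁻ g) x := by
  have hI : ∀ S : Finset (Fin d), Integrable fun ξ =>
      planeWave (WithLp.toLp 2 (partialShift h S)) ξ * g ξ := fun S =>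
    hg.bdd_mul (c := 1) (continuous_planeWave _).aestronglyMeasurable
      (Eventually.of_forall fun ξ => (norm_planeWave _ ξ).le)
  unfold euclideanDiff
  simp_rw [← fourierInv_planeWave_mul, Real.fourierInv_eq, ← integral_const_mul]
  rw [← integral_finsetSum]
  · congr 1
    ext ξ
    rw [diffSymbol, Finset.sum_mul, Finset.smul_sum]
    refine Finset.sum_congr rfl fun S _ => ?_
    simp only [Circle.smul_def, smul_eq_mul]
    ring
  · intro S _
    refine Integrable.const_mul ?_ _
    refine (hI S).norm.mono' ?_ (Eventually.of_forall fun ξ => (Circle.norm_smul _ _).le)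
    have hc : Continuous fun ξ : EuclideanSpace ℝ (Fin d) => Real.fourierChar (inner ℝ ξ x) :=
      Real.continuous_fourierChar.comp (by fun_prop)
    exact hc.aestronglyMeasurable.fun_smul (hI S).1

end Euclidean

/-- A function vanishing at infinity whose mixed differences vanish is zero. -/
lemma eq_zero_of_mixedDiff_eq_zero {d : ℕ} {W : (Fin d → ℝ) → ℂ}
    (hW : Tendsto W (cocompact _) (𝓝 0))
    (h0 : ∀ s : Fin d → ℤ, ∀ x, mixedDiff (fun k => dyadicStep (s k)) W x = 0)
    (x : Fin d → ℝ) : W x = 0 := by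
  -- The steps 2^n / 4 are sent to infinity: every shift with `S` nonempty escapes, and only the
  -- unshifted term W x survives.
  have hlim : Tendsto (fun n : ℕ => mixedDiff (fun _ => dyadicStep (-(n : ℤ))) W x) atTop
      (𝓝 (∑ S : Finset (Fin d), if S = ∅ then W x else 0)) := by
    refine tendsto_finsetSum _ fun S _ => ?_
    split_ifs with hS
    · subst hS
      have : ∀ h : Fin d → ℝ, x + partialShift h ∅ = x := fun h => by
        ext k; simp [partialShift]
      simp [this]
    · obtain ⟨k, hk⟩ := Finset.nonempty_iff_ne_empty.2 hS
      rw [← mul_zero ((-1 : ℂ) ^ S.card)]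
      refine (hW.comp ?_).const_mul _
      rw [← Metric.cobounded_eq_cocompact, ← tendsto_norm_atTop_iff_cobounded]
      have hstep : Tendsto (fun n : ℕ => (2 : ℝ) ^ n / 4 - |x k|) atTop atTop :=
        tendsto_atTop_add_const_right _ _
          ((tendsto_pow_atTop_atTop_of_one_lt one_lt_two).atTop_div_const (by norm_num))
      refine tendsto_atTop_mono (fun n => ?_) hstep
      refine le_trans ?_ (norm_le_pi_norm _ k)
      have h1 : (x + partialShift (fun _ => dyadicStep (-(n : ℤ))) S) k = x k + 2 ^ n / 4 := by
        simp [partialShift, hk, dyadicStep]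
      rw [h1, Real.norm_eq_abs]
      have h2 : |(2 : ℝ) ^ n / 4| = 2 ^ n / 4 := abs_of_nonneg (by positivity)
      have h3 := abs_sub_abs_le_abs_sub ((2 : ℝ) ^ n / 4) (-(x k))
      rw [abs_neg, h2, sub_neg_eq_add, add_comm _ (x k)] at h3
      exact h3
  have hz : (fun n : ℕ => mixedDiff (fun _ => dyadicStep (-(n : ℤ))) W x) = fun _ => 0 :=
    funext fun n => h0 (fun _ => -(n : ℤ)) x
  rw [hz] at hlim
  have := tendsto_nhds_unique hlim tendsto_const_nhds
  simpa using this

/-! ### Integrability of the transform and Fourier inversion -/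

section Inversion
variable {d : ℕ}

lemma lintegral_comp_ofLp (F : (Fin d → ℝ) → ENNReal) :
    ∫⁻ x : EuclideanSpace ℝ (Fin d), F (WithLp.ofLp x) = ∫⁻ x, F x :=
  (PiLp.volume_preserving_ofLp (Fin d)).lintegral_comp_emb
    (MeasurableEquiv.toLp 2 (Fin d → ℝ)).symm.measurableEmbedding F

lemma eLpNorm_two_eq {α : Type*} [MeasurableSpace α] {μ : Measure α} (u : α → ℂ) :
    eLpNorm u 2 μ = (∫⁻ x, ‖u x‖ₑ ^ (2 : ℝ) ∂μ) ^ (1 / 2 : ℝ) := by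
  rw [eLpNorm_eq_lintegral_rpow_enorm_toReal (by norm_num) (by norm_num)]
  simp

lemma setLIntegral_enorm_le {α : Type*} [MeasurableSpace α] {μ : Measure α} {v : α → ℂ}
    (hv : AEStronglyMeasurable v μ) (s : Set α) :
    ∫⁻ x in s, ‖v x‖ₑ ∂μ ≤ μ s ^ (1 / 2 : ℝ) * eLpNorm v 2 μ := by
  have h := ENNReal.lintegral_mul_le_Lp_mul_Lq (μ.restrict s) Real.HolderConjugate.two_two
    (f := fun _ => 1) (g := fun x => ‖v x‖ₑ) aemeasurable_const hv.enorm.restrict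
  simp only [Pi.mul_apply, one_mul, ENNReal.one_rpow, lintegral_one, Measure.restrict_apply_univ]
    at h
  refine h.trans ?_
  rw [eLpNorm_two_eq]
  gcongr
  exact Measure.restrict_le_self

/-- A function whose spectral pieces `v s` are controlled blockwise has an integrable symbol
quotient. -/
lemma integrable_of_dyadic {g : EuclideanSpace ℝ (Fin d) → ℂ}
    {v : (Fin d → ℤ) → EuclideanSpace ℝ (Fin d) → ℂ}
    (hg : AEStronglyMeasurable g) (hv : ∀ s, AEStronglyMeasurable (v s))
    (hvg : ∀ s, v s =ᵐ[volume] fun ξ => diffSymbol (fun k => dyadicStep (s k)) ξ * g ξ)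
    (hsum : ∑' s : Fin d → ℤ, ENNReal.ofReal (∏ k, (2 : ℝ) ^ s k) ^ (1 / 2 : ℝ) *
      eLpNorm (v s) 2 volume ≠ ⊤) : Integrable g := by
  refine ⟨hg, ?_⟩
  have hu : (⋃ s, dyadicBlock s : Set (EuclideanSpace ℝ (Fin d))) =ᵐ[volume] univ :=
    eventuallyEq_univ.2 ae_mem_iUnion_dyadicBlock
  -- On its block the symbol has modulus at least 1, so |g| ≤ |v s|; then Cauchy–Schwarz and the
  -- volume of the block.
  have hblock : ∀ s : Fin d → ℤ, ∫⁻ ξ in dyadicBlock s, ‖g ξ‖ₑ ≤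
      (4 ^ d) ^ (1 / 2 : ℝ) * (ENNReal.ofReal (∏ k, (2 : ℝ) ^ s k) ^ (1 / 2 : ℝ) *
        eLpNorm (v s) 2 volume) := fun s => by
    calc ∫⁻ ξ in dyadicBlock s, ‖g ξ‖ₑ ≤ ∫⁻ ξ in dyadicBlock s, ‖v s ξ‖ₑ := by
          refine lintegral_mono_ae ?_
          filter_upwards [ae_restrict_of_ae (hvg s),
            ae_restrict_mem (measurableSet_dyadicBlock s)] with ξ h1 h2
          rw [h1, enorm_mul]
          refine le_mul_of_one_le_left zero_le ?_
          rw [← ofReal_norm, ENNReal.one_le_ofReal]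
          exact one_le_norm_diffSymbol h2
      _ ≤ volume (dyadicBlock s) ^ (1 / 2 : ℝ) * eLpNorm (v s) 2 volume :=
          setLIntegral_enorm_le (hv s) _
      _ ≤ (4 ^ d * ENNReal.ofReal (∏ k, (2 : ℝ) ^ s k)) ^ (1 / 2 : ℝ) *
          eLpNorm (v s) 2 volume := by
          gcongr
          exact volume_dyadicBlock_le s
      _ = _ := by
          rw [ENNReal.mul_rpow_of_nonneg _ _ (show (0 : ℝ) ≤ 1 / 2 by norm_num), mul_assoc]
  rw [HasFiniteIntegral, ← setLIntegral_univ, ← setLIntegral_congr hu]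
  refine (lintegral_iUnion_le _ _).trans_lt ?_
  refine (ENNReal.tsum_le_tsum hblock).trans_lt ?_
  rw [ENNReal.tsum_mul_left]
  refine ENNReal.mul_lt_top ?_ hsum.lt_top
  exact ENNReal.rpow_lt_top_of_nonneg (by norm_num) (by finiteness)

/-- The spectral criterion: square-summability of the dyadic mixed differences gives an integrable
Fourier transform. -/
lemma exists_integrable_fourierInv {f : (Fin d → ℝ) → ℂ} (hf : Continuous f)
    (hf0 : Tendsto f (cocompact _) (𝓝 0))
    (hsum : ∑' s : Fin d → ℤ, ENNReal.ofReal (∏ k, (2 : ℝ) ^ s k) ^ (1 / 2 : ℝ) *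
      (∫⁻ x, ‖mixedDiff (fun k => dyadicStep (s k)) f x‖ₑ ^ (2 : ℝ)) ^ (1 / 2 : ℝ) ≠ ⊤) :
    ∃ g : EuclideanSpace ℝ (Fin d) → ℂ, Integrable g ∧
      ∀ y : Fin d → ℝ, f y = 𝓕⁻ g (WithLp.toLp 2 y) := by
  set F : EuclideanSpace ℝ (Fin d) → ℂ := fun x => f (WithLp.ofLp x) with hF
  set h : (Fin d → ℤ) → Fin d → ℝ := fun s k => dyadicStep (s k) with hh
  have hu : ∀ s x, euclideanDiff (h s) F x = mixedDiff (h s) f (WithLp.ofLp x) :=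
    fun s => euclideanDiff_comp_ofLp (h s) f
  have huc : ∀ s, Continuous (euclideanDiff (h s) F) := fun s => by
    have h1 : euclideanDiff (h s) F = fun x => mixedDiff (h s) f (WithLp.ofLp x) := funext (hu s)
    rw [h1]
    exact (continuous_mixedDiff hf _).comp (PiLp.continuous_ofLp 2 _)
  have hnorm : ∀ s, eLpNorm (euclideanDiff (h s) F) 2 volume =
      (∫⁻ x, ‖mixedDiff (h s) f x‖ₑ ^ (2 : ℝ)) ^ (1 / 2 : ℝ) := fun s => by
    rw [eLpNorm_two_eq, ← lintegral_comp_ofLp]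
    simp_rw [hu]
  -- The differences are square integrable although f itself need not be: each term of the
  -- convergent sum is finite and its weight is positive.
  have hmem : ∀ s, MemLp (euclideanDiff (h s) F) 2 := fun s => by
    refine ⟨(huc s).aestronglyMeasurable, ?_⟩
    rw [hnorm, lt_top_iff_ne_top]
    intro htop
    refine ENNReal.ne_top_of_tsum_ne_top hsum s ?_
    rw [htop]
    refine ENNReal.mul_top (ENNReal.rpow_pos ?_ ENNReal.ofReal_ne_top).ne'
    rw [ENNReal.ofReal_pos]
    exact Finset.prod_pos fun k _ => by positivity
  choose v hv hvn using fun s => exists_isL2Fourier (hmem s)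
  -- Differences with different steps commute, so the quotient of `v s` by its symbol does not
  -- depend on `s`; the index 0 is used to define `g`.
  have hcomm : ∀ s, (fun ξ => diffSymbol (h 0) ξ * v s ξ) =ᵐ[volume]
      fun ξ => diffSymbol (h s) ξ * v 0 ξ := fun s => by
    have h1 := (hv s).euclideanDiff (h 0)
    rw [euclideanDiff_comm] at h1
    exact h1.unique_right ((hv 0).euclideanDiff (h s))
  have hne : ∀ᵐ ξ, diffSymbol (h 0) ξ ≠ 0 := ae_diffSymbol_ne_zero fun k => dyadicStep_pos _
  set g : EuclideanSpace ℝ (Fin d) → ℂ := fun ξ => v 0 ξ / diffSymbol (h 0) ξ with hgdef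
  have hvg : ∀ s, v s =ᵐ[volume] fun ξ => diffSymbol (h s) ξ * g ξ := fun s => by
    filter_upwards [hcomm s, hne] with ξ h1 h2
    rw [hgdef]
    simp only
    field_simp
    rw [mul_comm, h1]
  have hg : Integrable g := by
    refine integrable_of_dyadic ?_ (fun s => (hv s).memLp_right.1) hvg ?_
    · exact ((hv 0).memLp_right.1.aemeasurable.div
        (continuous_diffSymbol _).aemeasurable).aestronglyMeasurable
    · simp_rw [hvn, hnorm]
      exact hsum
  refine ⟨g, hg, ?_⟩
  -- Inversion gives equality almost everywhere, and continuity of both sides makes it hold at every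
  -- point.
  have hdiff : ∀ s x, euclideanDiff (h s) F x = euclideanDiff (h s) (𝓕⁻ g) x := fun s => by
    have hgi : Integrable fun ξ => diffSymbol (h s) ξ * g ξ :=
      hg.bdd_mul (continuous_diffSymbol _).aestronglyMeasurable
        (Eventually.of_forall (norm_diffSymbol_le _))
    have hvi : Integrable (v s) := hgi.congr (hvg s).symm
    have h1 := (hv s).ae_eq_fourierInv hvi
    have h2 := ((huc s).ae_eq_iff_eq volume (continuous_fourierInv hvi)).1 h1
    intro x
    rw [h2, ← fourierInv_diffSymbol_mul _ hg, Real.fourierInv_eq, Real.fourierInv_eq]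
    refine integral_congr_ae ?_
    filter_upwards [hvg s] with ξ hξ
    rw [hξ]
  have hW : Tendsto (fun y => f y - 𝓕⁻ g (WithLp.toLp 2 y)) (cocompact _) (𝓝 0) := by
    have h1 : Tendsto (fun y : Fin d → ℝ => 𝓕⁻ g (WithLp.toLp 2 y)) (cocompact _) (𝓝 0) :=
      (tendsto_fourierInv_cocompact g).comp
        (PiLp.homeomorph 2 fun _ : Fin d => ℝ).symm.isClosedEmbedding.tendsto_cocompact
    simpa using hf0.sub h1
  intro y
  rw [← sub_eq_zero]
  refine eq_zero_of_mixedDiff_eq_zero hW (fun s x => ?_) y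
  have h1 := hdiff s (WithLp.toLp 2 x)
  rw [← sub_eq_zero] at h1
  rw [← h1]
  simp only [euclideanDiff, mixedDiff, ← Finset.sum_sub_distrib, hF]
  refine Finset.sum_congr rfl fun S _ => ?_
  rw [← mul_sub]
  rfl

/-- The substitution x ↦ x / (2π) removes 2π from the exponential; its Jacobian is the factor
(2π)^(-d). -/
lemma isAbsConvFourierIntegral_of_fourierInv {f : (Fin d → ℝ) → ℂ}
    {g : EuclideanSpace ℝ (Fin d) → ℂ} (hg : Integrable g)
    (hfg : ∀ y : Fin d → ℝ, f y = 𝓕⁻ g (WithLp.toLp 2 y)) : IsAbsConvFourierIntegral f := by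
  have hpi := Real.two_pi_pos
  have hvp := PiLp.volume_preserving_toLp (Fin d)
  have hemb : MeasurableEmbedding (WithLp.toLp 2 : (Fin d → ℝ) → EuclideanSpace ℝ (Fin d)) :=
    (MeasurableEquiv.toLp 2 (Fin d → ℝ)).measurableEmbedding
  have hg' : Integrable fun x : Fin d → ℝ => g (WithLp.toLp 2 x) :=
    (hvp.integrable_comp_emb hemb).2 hg
  refine ⟨fun x => ((2 * Real.pi) ^ d : ℝ)⁻¹ * g (WithLp.toLp 2 ((2 * Real.pi)⁻¹ • x)),
    ((integrable_comp_smul_iff volume (fun x : Fin d → ℝ => g (WithLp.toLp 2 x))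
      (inv_ne_zero hpi.ne')).2 hg').const_mul _, fun y => ?_⟩
  set G : (Fin d → ℝ) → ℂ := fun x => g (WithLp.toLp 2 x) *
    Complex.exp (2 * Real.pi * Complex.I * ((∑ k, x k * y k : ℝ) : ℂ)) with hG
  have h1 : f y = ∫ x, G x := by
    rw [hfg, Real.fourierInv_eq', ← hvp.integral_comp hemb]
    refine integral_congr_ae (Eventually.of_forall fun x => ?_)
    simp only [hG, smul_eq_mul]
    rw [mul_comm]
    congr 2
    simp only [PiLp.inner_apply, RCLike.inner_apply, conj_trivial]
    push_cast
    simp_rw [mul_comm]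
    ring
  have h2 := Measure.integral_comp_smul (volume : Measure (Fin d → ℝ)) G (2 * Real.pi)⁻¹
  rw [Module.finrank_fin_fun, inv_pow, inv_inv, abs_of_pos (by positivity)] at h2
  have h3 : (((2 * Real.pi) ^ d : ℝ) : ℂ) ≠ 0 := by
    exact_mod_cast (by positivity : ((2 * Real.pi) ^ d : ℝ) ≠ 0)
  rw [h1]
  simp_rw [mul_assoc]
  rw [integral_const_mul, Complex.ofReal_inv, eq_inv_mul_iff_mul_eq₀ h3, ← Complex.real_smul, ← h2]
  refine integral_congr_ae (Eventually.of_forall fun x => ?_)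
  simp only [hG]
  congr 2
  simp only [Pi.smul_apply, smul_eq_mul, mul_assoc, ← Finset.mul_sum]
  push_cast
  have : (Real.pi : ℂ) ≠ 0 := by exact_mod_cast Real.pi_ne_zero
  field_simp

end Inversion

theorem theorem2p1 {d : ℕ} (f : C₀(Fin d → ℝ, ℂ))
    (D : Finset (Fin d) → (Fin d → ℝ) → ℂ) (hD : IsMixedDerivFamily f D)
    (p : Finset (Fin d) → ℝ)
    (hp_zero : 1 ≤ p ∅) (hp : ∀ η : Finset (Fin d), η ≠ ∅ → 1 < p η)
    (hf : MemLp f (ENNReal.ofReal (p ∅)) volume)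
    (hDp : ∀ η : Finset (Fin d), η ≠ ∅ → MemLp (D η) (ENNReal.ofReal (p η)) volume)
    (hcond : ∀ η : Finset (Fin d), η ≠ ∅ → 1 < 1 / p ∅ + 1 / p η) :
    IsAbsConvFourierIntegral f := by
  rcases Nat.eq_zero_or_pos d with rfl | hd
  -- ℝ⁰ is a single point of mass 1, so f represents itself. This case is separate because the L²
  -- bounds need a nonempty set of variables.
  · have hvol : (volume : Measure (Fin 0 → ℝ)) = Measure.dirac 0 := by
      rw [volume_pi, Measure.pi_of_empty _ 0]
    refine ⟨f, ?_, fun y => ?_⟩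
    · rw [hvol]
      exact integrable_dirac (by simp)
    · rw [hvol, integral_dirac]
      simp [Subsingleton.elim y 0]
  · have hp1 : ∀ η, 1 ≤ p η := fun η => by
      rcases eq_or_ne η ∅ with rfl | hη
      exacts [hp_zero, (hp η hη).le]
    have hmem : ∀ η, MemLp (D η) (ENNReal.ofReal (p η)) volume := fun η => by
      rcases eq_or_ne η ∅ with rfl | hη
      · rw [hD.zero]
        exact hf
      · exact hDp η hη
    obtain ⟨g, hg, hfg⟩ := exists_integrable_fourierInv f.continuous f.zero_at_infty'
      (tsum_dyadic_mixedDiff_ne_top hd f.continuous (C := ‖f.toBCF‖)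
        (fun x => f.toBCF.norm_coe_le_norm x) hD
        (fun η => (hmem η).locallyIntegrable (by simpa using hp1 η)) hp_zero hp
        (fun η => by
          have hpos : 0 < p η := zero_lt_one.trans_le (hp1 η)
          have h1 := lintegral_rpow_enorm_lt_top_of_eLpNorm_lt_top (by simpa using hpos)
            ENNReal.ofReal_ne_top (hmem η).2
          rw [ENNReal.toReal_ofReal hpos.le] at h1
          exact h1.ne) hcond)
    exact isAbsConvFourierIntegral_of_fourierInv hg hfg
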